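/- **Setting.** Let $G=(V,E)$ be a finite graph, $\beta>0$, $\lambda\ge 0$, and let $\mathbf h=(\mathbf h_x)_{x\in V}$ with $\mathbf h_x:[0,\beta]\to\mathbb R$ integrable. Let $\Sigma$ be the set of càdlàg functions $[0,\beta]\to\{-1,1\}$, with the $\sigma$-algebra generated by the evaluations, and let $\varphi$ be the law on $\Sigma$ of the random path which, with equal probability, is one of the two paths that flip exactly at the points of a Poisson point process of intensity $\lambda$ on $[0,\beta]$. Write $\sigma\bullet\tau=\int_0^\beta\sigma(t)\tau(t)\,dt$. The quantum Ising (Gibbs) measure $\mu$ is the probability measure on $\Sigma^V$ with $$\mu(d\sigma)=\frac1Z\exp\Big(\sum_{\{i,j\}\in E}\sigma_i\bullet\sigma_j+\sum_{i\in V}\mathbf h_i\bullet\sigma_i\Big)\prod_{i\in V}\varphi(d\sigma_i).$$ For $x\in V$ and $\rho\in\Sigma^V$ let $\mu_x^\rho$ be the law of the configuration that equals $\rho$ off $x$ and whose spin at $x$ is drawn from the single-site Gibbs measure with field $\mathbf h_x+\sum_{y\sim x}\rho_y$, i.e. from the probability measure proportional to $\exp\big((\mathbf h_x+\sum_{y\sim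 x}\rho_y)\bullet s\big)\,\varphi(ds)$; view $\mu_x$ as a Markov kernel. For $A\subset V$ let $\mathcal L_A=\sum_{x\in A}(\mu_x-I)$ and $e^{t\mathcal L_A}=\sum_{n\ge0}e^{-t|A|}\frac{t^n}{n!}\sum_{x_1,\dots,x_n\in A}\mu_{x_1}\cdots\mu_{x_n}$. A censoring schedule is a function $A:\mathbb R^+\to\mathcal P(V)$ with finitely many discontinuities $t_1<\dots<t_n$ besides $t_0=0$; with $A_i=A(t_i^+)$, its dynamics is $$P_{A;t}=e^{(t_1-t_0)\mathcal L_{A_0}}e^{(t_2-t_1)\mathcal L_{A_1}}\cdots e^{(t-t_k)\mathcal L_{A_k}},\qquad k=\max\{i:t_i\le t\}.$$ A function $f:\Sigma^V\to\mathbb R$ is increasing if $f(\sigma)\le f(\tau)$ whenever, for every $x$, $\sigma_x(t)\le\tau_x(t)$ for almost every $t\in[0,\beta]$. A density is called increasing if it has a measurable increasing version. For probability measures, $\nu\prec\nu'$ means $\nu(f)\le\nu'(f)$ for all measurable increasing $f$. Finally, $\mathrm{Var}$ is the variance under $\mu$, $\mathrm{Ent}(f)=\mu(f\log f)-\mu(f)\log\mu(f)$,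 and $\|\nu-\mu\|_{\mathrm{TV}}=\sup_S|\nu(S)-\mu(S)|$. **Proposition 4.4.** Let $A,B$ be two censoring schedules with $A(t)\subset B(t)$ for all $t\ge0$, and let $\nu$ be a probability measure on $\Sigma^V$ that is absolutely continuous with respect to $\mu$, with $d\nu/d\mu\in L^2(\mu)$ and increasing. Then, for every $t\ge0$, both $\nu P_{A;t}$ and $\nu P_{B;t}$ are absolutely continuous with respect to $\mu$, their densities are increasing, $\nu P_{B;t}\prec\nu P_{A;t}$, the densities $f_A=\frac{d(\nu P_{A;t})}{d\mu}$ and $f_B=\frac{d(\nu P_{B;t})}{d\mu}$ are in $L^2(\mu)$, the functions $f_A\log f_A$ and $f_B\log f_B$ are $\mu$-integrable, and $$\mathrm{Var}(f_B)\le\mathrm{Var}(f_A),\qquad \mathrm{Ent}(f_B)\le\mathrm{Ent}(f_A),\qquad \|\nu P_{B;t}-\mu\|_{\mathrm{TV}}\le\|\nu P_{A;t}-\mu\|_{\mathrm{TV}}.$$ -/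

import Mathlib

open MeasureTheory ProbabilityTheory Filter Topology Set
open scoped NNReal ENNReal

noncomputable section

namespace QuantumIsing

/-! ### Single spins -/

/-- The set `Σ` of single spins: càdlàg functions `[0, β] → {-1, 1}`. It carries the
`σ`-algebra generated by the evaluations at the times `t ∈ [0, β]` (the instance on a subtype of
a product). -/
abbrev SpinPath (β : ℝ) : Type :=
  {σ : Icc (0 : ℝ) β → ℝ // (∀ t, σ t = 1 ∨ σ t = -1) ∧
    ∀ t, ContinuousWithinAt σ (Ici t) t ∧ ∃ l, Tendsto σ (𝓝[<] t) (𝓝 l)}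

/-- Spin configurations on the vertex set `V`, with the product `σ`-algebra. -/
abbrev Config (V : Type*) (β : ℝ) : Type _ := V → SpinPath β

/-- Lebesgue measure on the time interval `[0, β]`. -/
def timeMeasure (β : ℝ) : Measure (Icc (0 : ℝ) β) := volume.comap Subtype.val

/-- `σ • τ = ∫_{[0, β]} σ(t) τ(t) dt`. -/
def dot {β : ℝ} (σ τ : Icc (0 : ℝ) β → ℝ) : ℝ := ∫ t, σ t * τ t ∂(timeMeasure β)

/-- The function `t ↦ -1` if `u ≤ t`, and `1` otherwise. -/
def flipAt (β u : ℝ) (t : Icc (0 : ℝ) β) : ℝ := if u ≤ (t : ℝ) then -1 else 1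

lemma flipAt_continuousWithinAt (β u : ℝ) (t : Icc (0 : ℝ) β) :
    ContinuousWithinAt (flipAt β u) (Ici t) t := by
  by_cases h : u ≤ (t : ℝ)
  · refine (continuousWithinAt_const (b := (-1 : ℝ))).congr (fun s hs => ?_) ?_
    · have : u ≤ (s : ℝ) := h.trans hs
      simp [flipAt, this]
    · simp [flipAt, h]
  · have hlt : (t : ℝ) < u := not_le.1 h
    have hev : ∀ᶠ s : Icc (0 : ℝ) β in 𝓝 t, flipAt β u s = 1 := by
      have : ∀ᶠ s : Icc (0 : ℝ) β in 𝓝 t, (s : ℝ) < u :=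
        continuous_subtype_val.continuousAt.eventually (gt_mem_nhds hlt)
      filter_upwards [this] with s hs
      simp [flipAt, not_le.2 hs]
    have hc : ContinuousAt (flipAt β u) t :=
      (continuousAt_const (y := (1 : ℝ))).congr (hev.mono fun s hs => hs.symm)
    exact hc.continuousWithinAt

lemma flipAt_leftLim (β u : ℝ) (t : Icc (0 : ℝ) β) :
    ∃ l, Tendsto (flipAt β u) (𝓝[<] t) (𝓝 l) := by
  by_cases h : u < (t : ℝ)
  · refine ⟨-1, (tendsto_const_nhds (x := (-1 : ℝ))).congr' ?_⟩
    have : ∀ᶠ s : Icc (0 : ℝ) β in 𝓝[<] t, u < (s : ℝ) :=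
      nhdsWithin_le_nhds (continuous_subtype_val.continuousAt.eventually (lt_mem_nhds h))
    filter_upwards [this] with s hs
    simp [flipAt, hs.le]
  · refine ⟨1, (tendsto_const_nhds (x := (1 : ℝ))).congr' ?_⟩
    filter_upwards [self_mem_nhdsWithin] with s hs
    have : (s : ℝ) < u := lt_of_lt_of_le hs (not_lt.1 h)
    simp [flipAt, not_le.2 this]

lemma flipAt_sign (β u : ℝ) (t : Icc (0 : ℝ) β) : flipAt β u t = 1 ∨ flipAt β u t = -1 := by
  unfold flipAt; split_ifs <;> simp

/-- The two possible signs, as real numbers: `true ↦ 1` and `false ↦ -1`. -/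
def sgn (b : Bool) : ℝ := if b then 1 else -1

/-- The spin path which starts from the sign `b` and flips at each of the points
`u 0, …, u (n - 1)`. -/
def flipPath (β : ℝ) (b : Bool) (n : ℕ) (u : Fin n → ℝ) : SpinPath β :=
  ⟨fun t => sgn b * ∏ i, flipAt β (u i) t, by
    refine ⟨fun t => ?_, fun t => ⟨?_, ?_⟩⟩
    · have hp : ∀ s : Finset (Fin n),
          (∏ i ∈ s, flipAt β (u i) t) = 1 ∨ (∏ i ∈ s, flipAt β (u i) t) = -1 := by
        intro s
        induction s using Finset.induction_on with
        | empty => simp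
        | insert a s ha ih =>
          rw [Finset.prod_insert ha]
          rcases flipAt_sign β (u a) t with h | h <;> rcases ih with h' | h' <;> simp [h, h']
      rcases hp Finset.univ with h | h <;> cases b <;> simp [sgn, h]
    · have : ContinuousWithinAt (fun t => ∏ i, flipAt β (u i) t) (Ici t) t :=
        tendsto_finsetProd _ fun i _ => flipAt_continuousWithinAt β (u i) t
      exact this.const_mul _
    · choose l hl using fun i => flipAt_leftLim β (u i) t
      exact ⟨sgn b * ∏ i, l i, (tendsto_finsetProd _ fun i _ => hl i).const_mul _⟩⟩

lemma measurable_flipPath (β : ℝ) (b : Bool) (n : ℕ) : Measurable (flipPath β b n) := by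
  refine Measurable.subtype_mk (measurable_pi_lambda _ fun t => ?_)
  refine Measurable.const_mul (Finset.measurable_prod _ fun i _ => ?_) _
  exact Measurable.ite (measurableSet_le (measurable_pi_apply i) measurable_const)
    measurable_const measurable_const

/-- The law of the spin which starts from the sign `b` and flips at the points of a Poisson point
process of intensity `lam` on `[0, β]`: the number of points is Poisson of parameter `lam * β`
and, given their number, the points are independent and uniform on `[0, β]`. -/
def flipLaw (β : ℝ) (lam : ℝ≥0) (b : Bool) : Measure (SpinPath β) :=
  (poissonMeasure (lam * β.toNNReal)).bind fun n =>
    (Measure.pi fun _ : Fin n => volume[|Icc (0 : ℝ) β]).map (flipPath β b n)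

/-- The law `φ` of a single free spin: with equal probability, one of the two spin paths that flip
exactly at the points of the Poisson process. -/
def freeLaw (β : ℝ) (lam : ℝ≥0) : Measure (SpinPath β) :=
  (2 : ℝ≥0∞)⁻¹ • flipLaw β lam true + (2 : ℝ≥0∞)⁻¹ • flipLaw β lam false

/-! ### The Gibbs measure -/

section Gibbs

variable {V : Type*} [Fintype V] [DecidableEq V] (G : SimpleGraph V) [DecidableRel G.Adj]
  (β : ℝ) (h : V → Icc (0 : ℝ) β → ℝ) (lam : ℝ≥0)

/-- `∑_{i ∼ j} σ_i • σ_j + ∑_i h_i • σ_i`, where each edge is counted once. -/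
def energy (σ : Config V β) : ℝ :=
  ∑ e ∈ G.edgeFinset,
      Sym2.lift ⟨fun i j => dot (σ i).1 (σ j).1, fun i j => by simp only [dot, mul_comm]⟩ e
    + ∑ i, dot (h i) (σ i).1

/-- The Gibbs measure `μ`: the probability measure with density proportional to `exp (energy σ)`
with respect to the product of the free single spin laws. -/
def gibbs : Measure (Config V β) :=
  (Measure.pi fun _ : V => freeLaw β lam).tilted (energy G β h)

/-- The law of a spin at `x` given the other spins `ρ`: the single site Gibbs measure with field
`h_x + ∑_{y ∼ x} ρ_y`. -/
def siteLaw (x : V) (ρ : Config V β) : Measure (SpinPath β) :=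
  (freeLaw β lam).tilted
    fun s => dot (h x) s.1 + ∑ y ∈ G.neighborFinset x, dot (ρ y).1 s.1

end Gibbs

/-! ### Measurability of the heat bath updates -/

lemma measurable_eval (β : ℝ) :
    Measurable fun p : SpinPath β × Icc (0 : ℝ) β => p.1.1 p.2 := by
  rcases isEmpty_or_nonempty (Icc (0 : ℝ) β) with he | ⟨⟨t₀, ht₀⟩⟩
  · have : IsEmpty (SpinPath β × Icc (0 : ℝ) β) := ⟨fun p => he.elim p.2⟩
    exact measurable_of_empty _
  have hβ : (0 : ℝ) ≤ β := ht₀.1.trans ht₀.2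
  let d : ℕ → ℕ → Icc (0 : ℝ) β := fun n k => projIcc 0 β hβ (((k : ℝ) + 1) / ((n : ℝ) + 1))
  let a : ℕ → Icc (0 : ℝ) β → ℕ := fun n t => ⌊((n : ℝ) + 1) * (t : ℝ)⌋₊
  have ha : ∀ n, Measurable (a n) := fun n =>
    Nat.measurable_floor.comp (measurable_subtype_coe.const_mul _)
  refine measurable_of_tendsto_metrizable
    (f := fun n (p : SpinPath β × Icc (0 : ℝ) β) => p.1.1 (d n (a n p.2))) (fun n => ?_) ?_
  · have h1 : Measurable fun q : SpinPath β × ℕ => q.1.1 (d n q.2) :=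
      measurable_from_prod_countable_left fun k =>
        (measurable_pi_apply (d n k)).comp measurable_subtype_coe
    exact h1.comp (measurable_fst.prodMk ((ha n).comp measurable_snd))
  · rw [tendsto_pi_nhds]
    rintro ⟨σ, t⟩
    have hge : ∀ n, (t : ℝ) ≤ ((a n t : ℝ) + 1) / ((n : ℝ) + 1) := fun n => by
      rw [le_div_iff₀ (by positivity), mul_comm]
      exact (Nat.lt_floor_add_one _).le
    have hle : ∀ n, ((a n t : ℝ) + 1) / ((n : ℝ) + 1) ≤ t + 1 / ((n : ℝ) + 1) := fun n => by
      have h0 : (0 : ℝ) ≤ ((n : ℝ) + 1) * t := mul_nonneg (by positivity) t.2.1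
      have := Nat.floor_le h0
      rw [div_le_iff₀ (by positivity)]
      have hn : (n : ℝ) + 1 ≠ 0 := by positivity
      field_simp
      change (⌊((n : ℝ) + 1) * (t : ℝ)⌋₊ : ℝ) + 1 ≤ _
      linarith
    have hlim : Tendsto (fun n => ((a n t : ℝ) + 1) / ((n : ℝ) + 1)) atTop (𝓝 (t : ℝ)) := by
      refine tendsto_of_tendsto_of_tendsto_of_le_of_le tendsto_const_nhds ?_ hge hle
      simpa using (tendsto_one_div_add_atTop_nhds_zero_nat (𝕜 := ℝ)).const_add (t : ℝ)
    have hd : Tendsto (fun n => d n (a n t)) atTop (𝓝 t) := by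
      have := ((continuous_projIcc (h := hβ)).tendsto (t : ℝ)).comp hlim
      rwa [projIcc_val] at this
    have hd' : Tendsto (fun n => d n (a n t)) atTop (𝓝[≥] t) := by
      refine tendsto_nhdsWithin_iff.2 ⟨hd, Eventually.of_forall fun n => ?_⟩
      have := monotone_projIcc hβ (hge n)
      rwa [projIcc_val] at this
    exact (σ.2.2 t).1.tendsto.comp hd'

instance (β : ℝ) : IsFiniteMeasure (timeMeasure β) := by
  refine ⟨?_⟩
  rw [timeMeasure, (MeasurableEmbedding.subtype_coe measurableSet_Icc).comap_apply]
  refine lt_of_le_of_lt (measure_mono (t := Icc 0 β) ?_) measure_Icc_lt_top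
  rintro _ ⟨t, -, rfl⟩
  exact t.2

lemma measurable_dot_spins (β : ℝ) :
    Measurable fun p : SpinPath β × SpinPath β => dot p.1.1 p.2.1 := by
  have hm : Measurable fun q : (SpinPath β × SpinPath β) × Icc (0 : ℝ) β =>
      q.1.1.1 q.2 * q.1.2.1 q.2 :=
    ((measurable_eval β).comp ((measurable_fst.comp measurable_fst).prodMk measurable_snd)).mul
      ((measurable_eval β).comp ((measurable_snd.comp measurable_fst).prodMk measurable_snd))
  exact hm.stronglyMeasurable.integral_prod_right'.measurable

lemma measurable_path {β : ℝ} (s : SpinPath β) : Measurable s.1 :=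
  (measurable_eval β).comp (measurable_const.prodMk measurable_id)

lemma measurable_dot_field {β : ℝ} (f : Icc (0 : ℝ) β → ℝ) :
    Measurable fun s : SpinPath β => dot f s.1 := by
  by_cases hf : AEStronglyMeasurable f (timeMeasure β)
  · have heq : (fun s : SpinPath β => dot f s.1) = fun s => dot (hf.mk f) s.1 := by
      funext s
      refine integral_congr_ae ?_
      filter_upwards [hf.ae_eq_mk] with t ht
      simp only [← ht]
    rw [heq]
    have hm : Measurable fun q : SpinPath β × Icc (0 : ℝ) β => hf.mk f q.2 * q.1.1 q.2 :=
      (hf.stronglyMeasurable_mk.measurable.comp measurable_snd).mul (measurable_eval β)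
    exact hm.stronglyMeasurable.integral_prod_right'.measurable
  · have heq : (fun s : SpinPath β => dot f s.1) = fun _ => 0 := by
      funext s
      refine integral_non_aestronglyMeasurable fun hfs => hf ?_
      have h2 := hfs.mul (measurable_path s).aestronglyMeasurable
      refine h2.congr (Eventually.of_forall fun t => ?_)
      rcases s.2.1 t with h | h <;> simp [h]
    rw [heq]
    exact measurable_const

instance (β : ℝ) (lam : ℝ≥0) (b : Bool) : SFinite (flipLaw β lam b) := by
  have hc : IsFiniteMeasure (volume[|Icc (0 : ℝ) β]) := inferInstance
  have heq : flipLaw β lam b = Measure.sum fun n => poissonMeasure (lam * β.toNNReal) {n} •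
      (Measure.pi fun _ : Fin n => volume[|Icc (0 : ℝ) β]).map (flipPath β b n) := by
    ext s hs
    rw [flipLaw, Measure.bind_apply hs Measurable.of_discrete.aemeasurable,
      lintegral_countable', Measure.sum_apply _ hs]
    simp [mul_comm]
  rw [heq]
  infer_instance

instance (β : ℝ) (lam : ℝ≥0) : SFinite (freeLaw β lam) := by
  unfold freeLaw; infer_instance

/-! ### The heat bath dynamics -/

section Dynamics

variable {V : Type*} [Fintype V] [DecidableEq V] (G : SimpleGraph V) [DecidableRel G.Adj]
  (β : ℝ) (h : V → Icc (0 : ℝ) β → ℝ) (lam : ℝ≥0)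

lemma measurable_siteLaw_map (x : V) :
    Measurable fun ρ : Config V β =>
      (siteLaw G β h lam x ρ).map fun s => Function.update ρ x s := by
  have hF : Measurable fun p : Config V β × SpinPath β =>
      dot (h x) p.2.1 + ∑ y ∈ G.neighborFinset x, dot (p.1 y).1 p.2.1 := by
    refine ((measurable_dot_field (h x)).comp measurable_snd).add
      (Finset.measurable_sum _ fun y _ => ?_)
    have hy : Measurable fun p : Config V β × SpinPath β => (p.1 y, p.2) :=
      ((measurable_pi_apply y).comp measurable_fst).prodMk measurable_snd
    exact (measurable_dot_spins β).comp hy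
  have hE := Real.measurable_exp.comp hF
  have hZ : Measurable fun ρ : Config V β => ∫ s, Real.exp
      (dot (h x) s.1 + ∑ y ∈ G.neighborFinset x, dot (ρ y).1 s.1) ∂(freeLaw β lam) :=
    hE.stronglyMeasurable.integral_prod_right'.measurable
  have hD := (hE.div (hZ.comp measurable_fst)).ennreal_ofReal
  have hU : Measurable fun p : Config V β × SpinPath β => Function.update p.1 x p.2 :=
    measurable_update'
  refine Measure.measurable_of_measurable_coe _ fun S hS => ?_
  have heq : ∀ ρ : Config V β,
      ((siteLaw G β h lam x ρ).map fun s => Function.update ρ x s) S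
        = ∫⁻ s, ((fun p : Config V β × SpinPath β => Function.update p.1 x p.2) ⁻¹' S).indicator
            (fun p => ENNReal.ofReal (Real.exp
              (dot (h x) p.2.1 + ∑ y ∈ G.neighborFinset x, dot (p.1 y).1 p.2.1) /
              ∫ s, Real.exp (dot (h x) s.1 + ∑ y ∈ G.neighborFinset x, dot (p.1 y).1 s.1)
                ∂(freeLaw β lam))) (ρ, s) ∂(freeLaw β lam) := by
    intro ρ
    have hm : Measurable fun s => Function.update ρ x s := measurable_update ρ
    rw [Measure.map_apply hm hS, siteLaw, Measure.tilted, withDensity_apply _ (hm hS),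
      ← lintegral_indicator (hm hS)]
    rfl
  simp_rw [heq]
  exact (hD.indicator (hU hS)).lintegral_prod_right'

/-- The heat bath kernel `μ_x`: the spin at `x` is resampled from its law given the other spins,
which are kept. -/
def heatBath (x : V) : Kernel (Config V β) (Config V β) where
  toFun ρ := (siteLaw G β h lam x ρ).map fun s => Function.update ρ x s
  measurable' := measurable_siteLaw_map G β h lam x

/-- The kernel `e^{t L_A}` of the dynamics generated by `L_A = ∑_{x ∈ A} (μ_x - I)`, that is
`∑_n e^{-t|A|} (t^n / n!) ∑_{x_1, …, x_n ∈ A} μ_{x_1} ⋯ μ_{x_n}` (the power is the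
`n`-fold composition of kernels). -/
def heatFlow (A : Finset V) (t : ℝ≥0) : Kernel (Config V β) (Config V β) where
  toFun ρ := Measure.sum fun n : ℕ =>
    ENNReal.ofReal (Real.exp (-(t * A.card)) * t ^ n / n.factorial) •
      ((∑ x ∈ A, heatBath G β h lam x) ^ n) ρ
  measurable' := by
    refine Measure.measurable_of_measurable_coe _ fun S hS => ?_
    simp_rw [Measure.sum_apply _ hS, Measure.smul_apply, smul_eq_mul]
    exact Measurable.tsum fun n => (Kernel.measurable_coe _ hS).const_mul _

end Dynamics

/-- A function `A : ℝ₊ → 𝒫(V)` with finitely many discontinuities, together with an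
enumeration `0 = t_0 < t_1 < ⋯ < t_n` which contains all of them. Away from the `t_i`
the function is locally constant. -/
structure Schedule (V : Type*) where
  toFun : ℝ≥0 → Finset V
  n : ℕ
  time : Fin (n + 1) → ℝ≥0
  time_zero : time 0 = 0
  time_strictMono : StrictMono time
  locallyConstant : ∀ t, t ∉ range time → ∀ᶠ s in 𝓝 t, toFun s = toFun t

namespace Schedule

variable {V : Type*} [Fintype V] [DecidableEq V]

open Classical in
/-- The right limit `A(t^+)`. -/
def rightLim (A : Schedule V) (t : ℝ≥0) : Finset V :=
  Finset.univ.filter fun x => ∀ᶠ s in 𝓝[>] t, x ∈ A.toFun s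

/-- The time spent before `t` in the `i`-th interval: it is `min t t_{i+1} - t_i` for `i < n`
and `t - t_n` for `i = n`, and `0` if `t < t_i` (the subtraction of `ℝ≥0` is truncated). -/
def duration (A : Schedule V) (t : ℝ≥0) (i : Fin (A.n + 1)) : ℝ≥0 :=
  (if hi : (i : ℕ) + 1 < A.n + 1 then min t (A.time ⟨i + 1, hi⟩) else t) - A.time i

/-- The kernel `P_{A;t} = e^{(t_1 - t_0) L_{A_0}} e^{(t_2 - t_1) L_{A_1}} ⋯ e^{(t - t_k) L_{A_k}}`
of the censored dynamics, where `A_i = A(t_i^+)` and `k` is the largest index with `t_k ≤ t`.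
The update with `A_0` is performed first. The factors with index `i > k` have duration `0` and
are the identity. -/
def kernel (A : Schedule V) (G : SimpleGraph V) [DecidableRel G.Adj] (β : ℝ)
    (h : V → Icc (0 : ℝ) β → ℝ) (lam : ℝ≥0) (t : ℝ≥0) : Kernel (Config V β) (Config V β) :=
  (List.finRange (A.n + 1)).foldl
    (fun κ i => heatFlow G β h lam (A.rightLim (A.time i)) (A.duration t i) ∘ₖ κ) Kernel.id

/-- The law `ν P_{A;t}` at time `t` of the censored dynamics with initial law `ν`. -/
def law (A : Schedule V) (G : SimpleGraph V) [DecidableRel G.Adj] (β : ℝ)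
    (h : V → Icc (0 : ℝ) β → ℝ) (lam : ℝ≥0) (ν : Measure (Config V β)) (t : ℝ≥0) :
    Measure (Config V β) :=
  ν.bind (A.kernel G β h lam t)

end Schedule

/-! ### Order, variance, entropy and total variation -/

section Order

variable {V : Type*} {β : ℝ}

/-- `f` is increasing: `f σ ≤ f τ` as soon as, for every `x`, `σ_x(t) ≤ τ_x(t)` for almost every
`t ∈ [0, β]`. -/
def Increasing (f : Config V β → ℝ) : Prop :=
  ∀ σ τ : Config V β, (∀ x, ∀ᵐ t ∂(timeMeasure β), (σ x).1 t ≤ (τ x).1 t) → f σ ≤ f τ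

/-- The stochastic order `ν ≺ ν'`. An increasing real function on configurations is bounded
(by its values at the constant configurations `-1` and `1`), so that the integrals make sense. -/
def StochLE (ν ν' : Measure (Config V β)) : Prop :=
  ∀ f : Config V β → ℝ, Measurable f → Increasing f → ∫ σ, f σ ∂ν ≤ ∫ σ, f σ ∂ν'

/-- The density `dν/dμ` as a real function. -/
def density (ν μ : Measure (Config V β)) (σ : Config V β) : ℝ := (ν.rnDeriv μ σ).toReal

/-- The density `dν/dμ` is increasing: it has a (measurable) version which is. -/
def HasIncreasingDensity (ν μ : Measure (Config V β)) : Prop :=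
  ∃ f : Config V β → ℝ, Measurable f ∧ Increasing f ∧ density ν μ =ᵐ[μ] f

end Order

/-- `Ent(f) = μ(f log f) - μ(f) log μ(f)`. -/
def entropy {Ω : Type*} [MeasurableSpace Ω] (μ : Measure Ω) (f : Ω → ℝ) : ℝ :=
  ∫ ω, f ω * Real.log (f ω) ∂μ - (∫ ω, f ω ∂μ) * Real.log (∫ ω, f ω ∂μ)

/-- The total variation distance `sup_S |ν(S) - μ(S)|` of two probability measures. -/
def tvDist {Ω : Type*} [MeasurableSpace Ω] (ν μ : Measure Ω) : ℝ :=
  ⨆ S : {S : Set Ω // MeasurableSet S}, |ν.real S.1 - μ.real S.1|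

end QuantumIsing

end

noncomputable section

namespace QuantumIsing

/-! ### Positive association along a fixed finite set of possible flips -/

/-! This is the censoring argument of Peres and Winkler, with reversibility and positive association
as its two inputs. The heat bath kernel `μ_x` is the conditional expectation under `μ` given the
spins off `x`, so `∫ f μ_x(g) dμ = ∫ μ_x(f) μ_x(g) dμ`. When `f` and `g` are increasing and the
single-site laws are positively associated, `μ_x(f) μ_x(g) ≤ μ_x(fg)`, hence `∫ f μ_x(g) dμ ≤ ∫ f g
dμ`: an update can only lower the correlation of two increasing functions. Updates also preserve
monotonicity, so expanding the exponentials gives `∫ f e^{tL_B} g dμ ≤ ∫ f e^{tL_A} g dμ` for `A ⊆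
B` (`lintegral_mul_act_heatFlow_le`). By symmetry the density of the law evolves under the same
kernels as functions do, and the estimates on successive intervals chain together
(`exists_isMonoDensity_law`): `∫ f_B g dμ ≤ ∫ f_A g dμ` for every increasing `g`.

The analytic core is positive association of one spin in an integrable field (`freeLaw_fkg`). Fix
`N` points and give weight `r ^ (number of flips)` to each path that flips only at some of them.
Once the points are sorted such a path is a chain of `N + 1` signs, the weight is that of a
ferromagnetic Ising chain, the field term is modular, and the finite FKG inequality applies. Take `r
= c / N`, with `c` the Poisson parameter, and average over uniform points. The two paths in a
product share their points, but pairs of disjoint flip sets are independent, overlapping pairs have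
vanishing total weight, and binomial weights become Poisson weights (`tsum_poissonWeight_mul_le`).
Monotonicity of the single-site law in its field is a second use of the same inequality
(`freeLaw_tilted_mono`).

The three comparisons come from testing with functions of `f_B`, which is increasing: `f_B` for the
variance, `log (f_B + ε)` with Gibbs' inequality for the entropy, and the indicator of `{f_B > 1}`,
the optimal set, for total variation. Integrability is free: an increasing function is bounded by
its values at the two constant configurations. -/

/-- The order on spin paths: `σ ≤ τ` at almost every time. -/
def PathLE {β : ℝ} (σ τ : SpinPath β) : Prop := ∀ᵐ t ∂(timeMeasure β), σ.1 t ≤ τ.1 t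

/-- Functions on spin paths which are increasing for the almost everywhere order. -/
def PathMono {β : ℝ} {α : Type*} [LE α] (f : SpinPath β → α) : Prop :=
  ∀ σ τ, PathLE σ τ → f σ ≤ f τ

lemma abs_path {β : ℝ} (s : SpinPath β) (t : Icc (0 : ℝ) β) : |s.1 t| = 1 := by
  rcases s.2.1 t with h | h <;> simp [h]

lemma integrable_mul_path {β : ℝ} {k : Icc (0 : ℝ) β → ℝ} (hk : Integrable k (timeMeasure β))
    (s : SpinPath β) : Integrable (fun t => k t * s.1 t) (timeMeasure β) :=
  hk.mul_bdd (c := 1) (measurable_path s).aestronglyMeasurable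
    (Eventually.of_forall fun t => by simp [abs_path])

/-- The path which starts from the sign `b` and flips at the points `u i` with `i ∈ S`. -/
def subPath (β : ℝ) (b : Bool) {N : ℕ} (u : Fin N → ℝ) (S : Finset (Fin N)) : SpinPath β :=
  flipPath β b S.card (u ∘ S.orderEmbOfFin rfl)

lemma subPath_apply (β : ℝ) (b : Bool) {N : ℕ} (u : Fin N → ℝ) (S : Finset (Fin N))
    (t : Icc (0 : ℝ) β) : (subPath β b u S).1 t = sgn b * ∏ i ∈ S, flipAt β (u i) t := by
  have h : ∏ i ∈ S, flipAt β (u i) t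
      = ∏ i ∈ Finset.univ.map (S.orderEmbOfFin rfl).toEmbedding, flipAt β (u i) t := by
    rw [Finset.map_orderEmbOfFin_univ]
  rw [h, Finset.prod_map]
  rfl

/-- Relabelling the points only relabels the flip sets, so a sum over all flip sets may assume that
the points are sorted. -/
lemma subPath_comp_perm (β : ℝ) (b : Bool) {N : ℕ} (u : Fin N → ℝ) (S : Finset (Fin N))
    (π : Equiv.Perm (Fin N)) :
    subPath β b (u ∘ π) S = subPath β b u (S.map π.toEmbedding) := by
  apply Subtype.ext
  funext t
  rw [subPath_apply, subPath_apply, Finset.prod_map]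
  rfl

/-- The set of the flips of a chain of signs. -/
def jumps {N : ℕ} (s : Fin (N + 1) → Bool) : Finset (Fin N) :=
  Finset.univ.filter fun i => s i.castSucc ≠ s i.succ

/-- A chain of signs can be rebuilt from its first sign and the places where it changes; both sides
have `2 ^ (N + 1)` elements. -/
lemma bijective_jumps (N : ℕ) :
    Function.Bijective fun s : Fin (N + 1) → Bool => (s 0, jumps s) := by
  rw [Fintype.bijective_iff_injective_and_card]
  refine ⟨fun s s' hs => ?_, by simp [pow_succ, mul_comm]⟩
  obtain ⟨h0, hj⟩ := Prod.ext_iff.1 hs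
  funext k
  induction k using Fin.induction with
  | zero => exact h0
  | succ i ih =>
    have := Finset.ext_iff.1 hj i
    simp only [jumps, Finset.mem_filter, Finset.mem_univ, true_and, ih] at this
    revert this
    cases s i.succ <;> cases s' i.succ <;> cases s' i.castSucc <;> simp

/-- The path with flips among the points `u i` along which the signs are `s 0, …, s N`. -/
def chainPath (β : ℝ) {N : ℕ} (u : Fin N → ℝ) (s : Fin (N + 1) → Bool) : SpinPath β :=
  subPath β (s 0) u (jumps s)

/-- For sorted points, those at or before `t` form an initial segment, and the product telescopes
along it. The index `k` is the length of that segment; it does not depend on `s`, so evaluation at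
`t` is a coordinate of the chain. -/
lemma exists_sgn_eq_prod_flipAt (β : ℝ) (t : Icc (0 : ℝ) β) {N : ℕ} {u : Fin N → ℝ}
    (hu : Monotone u) : ∃ k : Fin (N + 1), ∀ s : Fin (N + 1) → Bool,
      sgn (s 0) * ∏ i, (if s i.castSucc ≠ s i.succ then flipAt β (u i) t else 1) = sgn (s k) := by
  induction N with
  | zero => exact ⟨0, fun s => by simp⟩
  | succ N ih =>
    by_cases h : u 0 ≤ (t : ℝ)
    · obtain ⟨k, hk⟩ := ih (u := fun i => u i.succ) fun i j hij => hu (Fin.succ_le_succ_iff.2 hij)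
      refine ⟨k.succ, fun s => ?_⟩
      rw [← hk fun i => s i.succ, Fin.prod_univ_succ, ← mul_assoc]
      have h1 : flipAt β (u 0) t = -1 := by simp [flipAt, h]
      congr 1
      rw [h1]
      simp only [Fin.castSucc_zero]
      have h2 : ∀ x y : Bool, (sgn x * if x ≠ y then -1 else 1) = sgn y := by
        intro x y; cases x <;> cases y <;> simp [sgn]
      exact h2 _ _
    · refine ⟨0, fun s => ?_⟩
      have h1 : ∀ i, flipAt β (u i) t = 1 := fun i => by
        have : ¬ u i ≤ (t : ℝ) := fun hi => h ((hu (Fin.zero_le i)).trans hi)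
        simp [flipAt, this]
      simp [h1]

lemma exists_chainPath_apply (β : ℝ) {N : ℕ} {u : Fin N → ℝ} (hu : Monotone u)
    (t : Icc (0 : ℝ) β) :
    ∃ k : Fin (N + 1), ∀ s : Fin (N + 1) → Bool, (chainPath β u s).1 t = sgn (s k) := by
  obtain ⟨k, hk⟩ := exists_sgn_eq_prod_flipAt β t hu
  refine ⟨k, fun s => ?_⟩
  rw [← hk s, chainPath, subPath_apply, jumps, Finset.prod_filter]

lemma sgn_mono : Monotone sgn := by
  intro a b hab
  cases a <;> cases b <;> first | exact absurd hab (by decide) | norm_num [sgn]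

lemma chainPath_mono (β : ℝ) {N : ℕ} {u : Fin N → ℝ} (hu : Monotone u)
    {s s' : Fin (N + 1) → Bool} (hs : s ≤ s') : PathLE (chainPath β u s) (chainPath β u s') := by
  refine Eventually.of_forall fun t => ?_
  obtain ⟨k, hk⟩ := exists_chainPath_apply β hu t
  rw [hk, hk]
  exact sgn_mono (hs k)

/-- At each time all four paths read the same coordinate `j`, and the minimum and maximum of `a j`
and `b j` are these two values in some order. The field therefore contributes a modular energy. -/
lemma dot_chainPath_inf_add_sup {β : ℝ} {k : Icc (0 : ℝ) β → ℝ}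
    (hk : Integrable k (timeMeasure β)) {N : ℕ} {u : Fin N → ℝ} (hu : Monotone u)
    (a b : Fin (N + 1) → Bool) :
    dot k (chainPath β u (a ⊓ b)).1 + dot k (chainPath β u (a ⊔ b)).1
      = dot k (chainPath β u a).1 + dot k (chainPath β u b).1 := by
  simp only [dot]
  rw [← integral_add (integrable_mul_path hk _) (integrable_mul_path hk _),
    ← integral_add (integrable_mul_path hk _) (integrable_mul_path hk _)]
  congr 1
  funext t
  obtain ⟨j, hj⟩ := exists_chainPath_apply β hu t
  simp only [hj, Pi.inf_apply, Pi.sup_apply]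
  cases a j <;> cases b j <;> simp [sgn, add_comm]

/-- The lattice condition of a ferromagnetic Ising chain, checked bond by bond. The bound `r ≤ 1`
enters when `a` and `b` jump in opposite directions: both jumps disappear in the infimum and the
supremum. -/
lemma pow_card_jumps_mul_le {N : ℕ} {r : ℝ≥0} (hr : r ≤ 1) (a b : Fin (N + 1) → Bool) :
    r ^ (jumps a).card * r ^ (jumps b).card
      ≤ r ^ (jumps (a ⊓ b)).card * r ^ (jumps (a ⊔ b)).card := by
  have h : ∀ s : Fin (N + 1) → Bool,
      r ^ (jumps s).card = ∏ i : Fin N, if s i.castSucc ≠ s i.succ then r else 1 := fun s => by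
    rw [jumps, ← Finset.prod_const, Finset.prod_filter]
  rw [h, h, h, h, ← Finset.prod_mul_distrib, ← Finset.prod_mul_distrib]
  refine Finset.prod_le_prod' fun i _ => ?_
  have hr2 : r * r ≤ 1 := mul_le_one' hr hr
  have h2 : ∀ x y z w : Bool, ((if x ≠ y then r else 1) * if z ≠ w then r else 1)
      ≤ (if x ⊓ z ≠ y ⊓ w then r else 1) * if x ⊔ z ≠ y ⊔ w then r else 1 := by
    intro x y z w
    cases x <;> cases y <;> cases z <;> cases w <;> simp [hr2]
  exact h2 _ _ _ _

/-- The weight `exp (k • σ)` of a path in the field `k`. -/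
def fieldWeight {β : ℝ} (k : Icc (0 : ℝ) β → ℝ) (s : SpinPath β) : ℝ≥0 := (Real.exp (dot k s.1)).toNNReal

lemma chainPath_fkg {β : ℝ} {k : Icc (0 : ℝ) β → ℝ} (hk : Integrable k (timeMeasure β))
    {N : ℕ} {u : Fin N → ℝ} (hu : Monotone u) {r : ℝ≥0} (hr : r ≤ 1)
    {f g : SpinPath β → ℝ≥0} (hf : PathMono f) (hg : PathMono g) :
    (∑ s, r ^ (jumps s).card * (fieldWeight k (chainPath β u s) * f (chainPath β u s))) *
      (∑ s, r ^ (jumps s).card * (fieldWeight k (chainPath β u s) * g (chainPath β u s)))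
    ≤ (∑ s, r ^ (jumps s).card * fieldWeight k (chainPath β u s)) *
      (∑ s, r ^ (jumps s).card *
        (fieldWeight k (chainPath β u s) * (f (chainPath β u s) * g (chainPath β u s)))) := by
  have := fkg (fun s => f (chainPath β u s)) (fun s => g (chainPath β u s))
    (fun s => r ^ (jumps s).card * fieldWeight k (chainPath β u s))
    (fun _ => zero_le) (fun _ => zero_le) (fun _ => zero_le)
    (fun _ _ h => hf _ _ (chainPath_mono β hu h)) (fun _ _ h => hg _ _ (chainPath_mono β hu h)) ?_
  · simpa only [mul_assoc] using this
  · intro a b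
    have hw : fieldWeight k (chainPath β u a) * fieldWeight k (chainPath β u b)
        = fieldWeight k (chainPath β u (a ⊓ b)) * fieldWeight k (chainPath β u (a ⊔ b)) := by
      simp only [fieldWeight]
      rw [← Real.toNNReal_mul (Real.exp_pos _).le, ← Real.toNNReal_mul (Real.exp_pos _).le,
        ← Real.exp_add, ← Real.exp_add, dot_chainPath_inf_add_sup hk hu]
    calc _ = r ^ (jumps a).card * r ^ (jumps b).card *
          (fieldWeight k (chainPath β u a) * fieldWeight k (chainPath β u b)) := by ring
      _ ≤ r ^ (jumps (a ⊓ b)).card * r ^ (jumps (a ⊔ b)).card *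
          (fieldWeight k (chainPath β u a) * fieldWeight k (chainPath β u b)) :=
        mul_le_mul_left (pow_card_jumps_mul_le hr a b) _
      _ = _ := by rw [hw]; ring

/-- The sum over all paths with flips among the points `u i`, where each flip has weight `r`. -/
def flipSum {β : ℝ} {N : ℕ} (r : ℝ≥0) (u : Fin N → ℝ) (F : SpinPath β → ℝ≥0) : ℝ≥0 :=
  ∑ p : Bool × Finset (Fin N), r ^ p.2.card * F (subPath β p.1 u p.2)

/-- The sum runs over all flip sets, so sorting the points does not change it; `bijective_jumps`
then turns flip sets into sign chains. -/
lemma flipSum_eq_sum_chainPath {β : ℝ} {N : ℕ} (r : ℝ≥0) (u : Fin N → ℝ)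
    (F : SpinPath β → ℝ≥0) :
    flipSum r u F = ∑ s, r ^ (jumps s).card * F (chainPath β (u ∘ Tuple.sort u) s) := by
  have h1 : ∑ s, r ^ (jumps s).card * F (chainPath β (u ∘ Tuple.sort u) s)
      = ∑ p : Bool × Finset (Fin N),
        r ^ p.2.card * F (subPath β p.1 (u ∘ Tuple.sort u) p.2) :=
    (bijective_jumps N).sum_comp
      fun p => r ^ p.2.card * F (subPath β p.1 (u ∘ Tuple.sort u) p.2)
  rw [h1, flipSum]
  symm
  refine Fintype.sum_equiv ((Equiv.refl Bool).prodCongr (Tuple.sort u).finsetCongr) _ _ fun p => ?_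
  simp [subPath_comp_perm]

lemma flipSum_fkg {β : ℝ} {k : Icc (0 : ℝ) β → ℝ} (hk : Integrable k (timeMeasure β))
    {N : ℕ} (u : Fin N → ℝ) {r : ℝ≥0} (hr : r ≤ 1)
    {f g : SpinPath β → ℝ≥0} (hf : PathMono f) (hg : PathMono g) :
    flipSum r u (fun s => fieldWeight k s * f s) * flipSum r u (fun s => fieldWeight k s * g s)
      ≤ flipSum r u (fieldWeight k) * flipSum r u (fun s => fieldWeight k s * (f s * g s)) := by
  simp only [flipSum_eq_sum_chainPath]
  exact chainPath_fkg hk (Tuple.monotone_sort u) hr hf hg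

/-! ### Positive association of the free single spin law -/

/-- The uniform distribution on `[0, β]`. -/
abbrev uniformTime (β : ℝ) : Measure ℝ := volume[|Icc (0 : ℝ) β]

lemma isProbabilityMeasure_uniformTime {β : ℝ} (hβ : 0 < β) :
    IsProbabilityMeasure (uniformTime β) :=
  cond_isProbabilityMeasure_of_finite (by simp [hβ]) (by simp)

/-- The integral of `F` over the two paths which flip at `n` uniform points. -/
def flipMean (β : ℝ) (F : SpinPath β → ℝ≥0) (n : ℕ) : ℝ≥0∞ :=
  ∫⁻ v, ((∑ b, F (flipPath β b n v) : ℝ≥0) : ℝ≥0∞) ∂(Measure.pi fun _ : Fin n => uniformTime β)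

lemma measurable_sum_flipPath {β : ℝ} {F : SpinPath β → ℝ≥0} (hF : Measurable F) (n : ℕ) :
    Measurable fun v => ∑ b, F (flipPath β b n v) :=
  Finset.measurable_sum _ fun b _ => hF.comp (measurable_flipPath β b n)

lemma flipMean_le {β : ℝ} (hβ : 0 < β) {F : SpinPath β → ℝ≥0} {M : ℝ≥0} (hM : ∀ s, F s ≤ M)
    (n : ℕ) : flipMean β F n ≤ ((2 * M : ℝ≥0) : ℝ≥0∞) := by
  have := isProbabilityMeasure_uniformTime hβ
  calc flipMean β F n
      ≤ ∫⁻ _, ((2 * M : ℝ≥0) : ℝ≥0∞) ∂(Measure.pi fun _ : Fin n => uniformTime β) := by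
        refine lintegral_mono fun v => ENNReal.coe_le_coe.2 ?_
        calc ∑ b, F (flipPath β b n v) ≤ ∑ _b : Bool, M := Finset.sum_le_sum fun b _ => hM _
          _ = 2 * M := by simp
    _ = _ := by simp

lemma lintegral_flipLaw {β : ℝ} (lam : ℝ≥0) (b : Bool) {F : SpinPath β → ℝ≥0∞}
    (hF : Measurable F) : ∫⁻ s, F s ∂(flipLaw β lam b)
      = ∑' n, ENNReal.ofReal (Real.exp (-(lam * β.toNNReal : ℝ≥0)) *
          (lam * β.toNNReal : ℝ≥0) ^ n / n.factorial) *
        ∫⁻ v, F (flipPath β b n v) ∂(Measure.pi fun _ : Fin n => uniformTime β) := by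
  rw [flipLaw, Measure.lintegral_bind Measurable.of_discrete.aemeasurable hF.aemeasurable,
    lintegral_countable']
  refine tsum_congr fun n => ?_
  rw [lintegral_map hF (measurable_flipPath β b n), poissonMeasure_singleton, mul_comm]

/-- The unnormalized Poisson weight. -/
def poissonWeight (c : ℝ≥0) (n : ℕ) : ℝ≥0 := c ^ n / n.factorial

/-- The prefactor does not depend on `F`, so it occurs equally on both sides of the FKG inequality,
and only the Poisson series has to be studied. -/
lemma lintegral_freeLaw {β : ℝ} (lam : ℝ≥0) {F : SpinPath β → ℝ≥0} (hF : Measurable F) :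
    ∫⁻ s, F s ∂(freeLaw β lam)
      = (2 : ℝ≥0∞)⁻¹ * ENNReal.ofReal (Real.exp (-(lam * β.toNNReal : ℝ≥0))) *
        ∑' n, (poissonWeight (lam * β.toNNReal) n : ℝ≥0∞) * flipMean β F n := by
  have hF' : Measurable fun s => (F s : ℝ≥0∞) := hF.coe_nnreal_ennreal
  set c := lam * β.toNNReal with hc
  have hw : ∀ n : ℕ, ENNReal.ofReal (Real.exp (-(c : ℝ)) * (c : ℝ) ^ n / n.factorial)
      = ENNReal.ofReal (Real.exp (-(c : ℝ))) * poissonWeight c n := fun n => by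
    rw [mul_div_assoc, ENNReal.ofReal_mul (Real.exp_pos _).le]
    congr 1
    rw [← ENNReal.ofReal_coe_nnreal]
    simp [poissonWeight]
  rw [freeLaw, lintegral_add_measure, lintegral_smul_measure, lintegral_smul_measure,
    lintegral_flipLaw _ _ hF', lintegral_flipLaw _ _ hF', ← hc, smul_eq_mul, smul_eq_mul,
    ← mul_add, mul_assoc, ← ENNReal.tsum_add]
  congr 1
  rw [← ENNReal.tsum_mul_left]
  refine tsum_congr fun n => ?_
  have hm : ∀ b, Measurable fun v => (F (flipPath β b n v) : ℝ≥0∞) := fun b =>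
    hF'.comp (measurable_flipPath β b n)
  rw [hw, ← mul_add, ← lintegral_add_left (hm true), mul_assoc, flipMean]
  simp

lemma isProbabilityMeasure_freeLaw {β : ℝ} (hβ : 0 < β) (lam : ℝ≥0) :
    IsProbabilityMeasure (freeLaw β lam) := by
  have := isProbabilityMeasure_uniformTime hβ
  have h1 : ∀ b, flipLaw β lam b univ = 1 := fun b => by
    rw [← lintegral_one, lintegral_flipLaw lam b measurable_const]
    simp only [lintegral_const, measure_univ, mul_one]
    rw [← ENNReal.ofReal_tsum_of_nonneg (fun n => by positivity)
      (hasSum_one_poissonMeasure _).summable, (hasSum_one_poissonMeasure _).tsum_eq]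
    simp
  refine ⟨?_⟩
  simp [freeLaw, h1, ENNReal.inv_two_add_inv_two]

lemma map_comp_embedding_pi {U : Measure ℝ} [IsProbabilityMeasure U] {k N : ℕ}
    {e : Fin k → Fin N} (he : Function.Injective e) :
    (Measure.pi fun _ : Fin N => U).map (fun u => u ∘ e) = Measure.pi fun _ : Fin k => U := by
  have hi : iIndepFun (fun (i : Fin N) (u : Fin N → ℝ) => u i) (Measure.pi fun _ : Fin N => U) :=
    iIndepFun_pi (X := fun _ => id) fun _ => aemeasurable_id
  have := (iIndepFun_iff_map_fun_eq_pi_map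
    fun j => (measurable_pi_apply (e j)).aemeasurable).1 (hi.precomp he)
  refine (this.trans ?_)
  congr 1
  funext j
  exact (measurePreserving_eval (fun _ : Fin N => U) (e j)).map_eq

/-- The points selected by `S` are `S.card` independent uniform points, so only the cardinality
matters. -/
lemma lintegral_subPath {β : ℝ} (hβ : 0 < β) {F : SpinPath β → ℝ≥0} (hF : Measurable F) {N : ℕ}
    (S : Finset (Fin N)) :
    ∫⁻ u, ((∑ b, F (subPath β b u S) : ℝ≥0) : ℝ≥0∞) ∂(Measure.pi fun _ : Fin N => uniformTime β)
      = flipMean β F S.card := by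
  have := isProbabilityMeasure_uniformTime hβ
  rw [flipMean, ← map_comp_embedding_pi (S.orderEmbOfFin rfl).injective,
    lintegral_map (measurable_sum_flipPath hF _).coe_nnreal_ennreal]
  · rfl
  · exact measurable_pi_lambda _ fun j => measurable_pi_apply _

/-- Disjoint sets of coordinates are independent. This is how a product of two means arises although
both paths draw on the same points. -/
lemma lintegral_subPath_mul {β : ℝ} (hβ : 0 < β) {F F' : SpinPath β → ℝ≥0} (hF : Measurable F)
    (hF' : Measurable F') {N : ℕ} {S S' : Finset (Fin N)} (hS : Disjoint S S') :
    ∫⁻ u, ((∑ b, F (subPath β b u S) : ℝ≥0) : ℝ≥0∞) * ((∑ b, F' (subPath β b u S') : ℝ≥0) : ℝ≥0∞)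
        ∂(Measure.pi fun _ : Fin N => uniformTime β)
      = flipMean β F S.card * flipMean β F' S'.card := by
  have := isProbabilityMeasure_uniformTime hβ
  have hi : iIndepFun (fun (i : Fin N) (u : Fin N → ℝ) => u i)
      (Measure.pi fun _ : Fin N => uniformTime β) :=
    iIndepFun_pi (X := fun _ => id) fun _ => aemeasurable_id
  have h2 := hi.indepFun_finset S S' hS fun i => measurable_pi_apply i
  have hm : ∀ {F : SpinPath β → ℝ≥0}, Measurable F → ∀ S : Finset (Fin N),
      Measurable fun a : S → ℝ => ((∑ b, F (flipPath β b S.card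
        fun j => a ⟨S.orderEmbOfFin rfl j, S.orderEmbOfFin_mem rfl j⟩) : ℝ≥0) : ℝ≥0∞) :=
    fun hF S => ((measurable_sum_flipPath hF _).comp
      (measurable_pi_lambda _ fun j => measurable_pi_apply _)).coe_nnreal_ennreal
  have hres : ∀ S : Finset (Fin N), Measurable fun (u : Fin N → ℝ) (i : S) => u i := fun S =>
    measurable_pi_lambda _ fun j => measurable_pi_apply _
  rw [← lintegral_subPath hβ hF S, ← lintegral_subPath hβ hF' S']
  exact lintegral_mul_eq_lintegral_mul_lintegral_of_indepFun''
    ((hm hF S).comp (hres S)).aemeasurable ((hm hF' S').comp (hres S')).aemeasurable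
    (h2.comp (hm hF S) (hm hF' S'))

/-! ### Pairs of flip sets and the passage from binomial to Poisson weights -/

/-- The number of pairs of disjoint sets of sizes `k` and `l` in a set of size `N`, each pair
weighted by `r ^ (k + l)`. -/
def pairWeight (r : ℝ≥0) (N k l : ℕ) : ℝ≥0 := (N.choose k * r ^ k) * ((N - k).choose l * r ^ l)

/-- Choose `S` of size `k`, then `S'` of size `l` in its complement. The series are finite sums, as
the binomial coefficients vanish beyond `N`. -/
lemma sum_disjoint_pairs {N : ℕ} (r : ℝ≥0) (a b : ℕ → ℝ≥0∞) :
    ∑ S : Finset (Fin N), ∑ S' : Finset (Fin N), (if Disjoint S S' then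
        ((r ^ S.card * r ^ S'.card : ℝ≥0) : ℝ≥0∞) * (a S.card * b S'.card) else 0)
      = ∑' k, ∑' l, (pairWeight r N k l : ℝ≥0∞) * (a k * b l) := by
  have h1 : ∀ S : Finset (Fin N), ∑ S' : Finset (Fin N), (if Disjoint S S' then
        ((r ^ S.card * r ^ S'.card : ℝ≥0) : ℝ≥0∞) * (a S.card * b S'.card) else 0)
      = ∑' l, ((N - S.card).choose l : ℝ≥0∞) *
        (((r ^ S.card * r ^ l : ℝ≥0) : ℝ≥0∞) * (a S.card * b l)) := fun S => by
    have : (Finset.univ.filter fun S' => Disjoint S S') = Sᶜ.powerset := by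
      ext S'; simp [Finset.subset_compl_iff_disjoint_left]
    rw [← Finset.sum_filter, this, Finset.sum_powerset_apply_card
      (fun l => ((r ^ S.card * r ^ l : ℝ≥0) : ℝ≥0∞) * (a S.card * b l)),
      Finset.card_compl, Fintype.card_fin, tsum_eq_sum (s := Finset.range (N - S.card + 1))]
    · simp only [nsmul_eq_mul]
    · intro l hl
      rw [Nat.choose_eq_zero_of_lt (by simpa [Nat.lt_succ_iff] using hl)]
      simp
  simp_rw [h1]
  rw [← Finset.powerset_univ, Finset.sum_powerset_apply_card (fun k => ∑' l,
      ((N - k).choose l : ℝ≥0∞) * (((r ^ k * r ^ l : ℝ≥0) : ℝ≥0∞) * (a k * b l))),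
      Finset.card_univ, Fintype.card_fin, tsum_eq_sum (s := Finset.range (N + 1))]
  · refine Finset.sum_congr rfl fun k _ => ?_
    rw [nsmul_eq_mul, ← ENNReal.tsum_mul_left]
    refine tsum_congr fun l => ?_
    simp only [pairWeight]
    push_cast
    ring
  · intro k hk
    simp [pairWeight, Nat.choose_eq_zero_of_lt (show N < k by simpa [Nat.lt_succ_iff] using hk)]

/-- The weight of the pairs of subsets of a set of size `N` which are not disjoint. -/
def overlapWeight (r : ℝ≥0) (N : ℕ) : ℝ≥0 :=
  ∑ S : Finset (Fin N), ∑ S' : Finset (Fin N), if Disjoint S S' then 0 else r ^ S.card * r ^ S'.card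

lemma sum_pow_card (r : ℝ≥0) {N : ℕ} (s : Finset (Fin N)) :
    ∑ S ∈ s.powerset, r ^ S.card = (r + 1) ^ s.card := by
  rw [← Finset.sum_pow_mul_eq_add_pow]
  simp

/-- Over all pairs, each point contributes `(1 + r) ^ 2`. Over disjoint pairs it lies in neither
set, in `S` or in `S'`, and contributes `1 + 2 * r`. -/
lemma overlapWeight_add (r : ℝ≥0) (N : ℕ) :
    overlapWeight r N + (1 + 2 * r) ^ N = ((1 + r) ^ N) ^ 2 := by
  have h1 : ((1 + r) ^ N) ^ 2 = ∑ S : Finset (Fin N), ∑ S' : Finset (Fin N),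
      r ^ S.card * r ^ S'.card := by
    have := sum_pow_card r (Finset.univ : Finset (Fin N))
    rw [Finset.powerset_univ, Finset.card_univ, Fintype.card_fin] at this
    rw [sq, add_comm 1 r, ← this, Finset.sum_mul_sum]
  have h2 : (1 + 2 * r) ^ N = ∑ S : Finset (Fin N), ∑ S' : Finset (Fin N),
      if Disjoint S S' then r ^ S.card * r ^ S'.card else 0 := by
    have h3 : ∀ S : Finset (Fin N), (∑ S' : Finset (Fin N),
        if Disjoint S S' then r ^ S.card * r ^ S'.card else 0)
        = r ^ S.card * (r + 1) ^ (N - S.card) := fun S => by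
      have : (Finset.univ.filter fun S' => Disjoint S S') = Sᶜ.powerset := by
        ext S'; simp [Finset.subset_compl_iff_disjoint_left]
      rw [← Finset.sum_filter, this, ← Finset.mul_sum, sum_pow_card, Finset.card_compl,
        Fintype.card_fin]
    simp_rw [h3]
    have := Finset.sum_pow_mul_eq_add_pow r (r + 1) (Finset.univ : Finset (Fin N))
    rw [Finset.powerset_univ, Finset.card_univ, Fintype.card_fin] at this
    rw [this]
    ring
  rw [h1, h2, overlapWeight, ← Finset.sum_add_distrib]
  refine Finset.sum_congr rfl fun S _ => ?_
  rw [← Finset.sum_add_distrib]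
  refine Finset.sum_congr rfl fun S' _ => ?_
  split_ifs <;> simp

/-- In the limit the total weight `(exp c) ^ 2` of all pairs equals the weight `exp (2 * c)` of the
disjoint ones, so sharing the points costs nothing asymptotically. -/
lemma tendsto_overlapWeight (c : ℝ≥0) :
    Tendsto (fun N : ℕ => overlapWeight (c / N) N) atTop (𝓝 0) := by
  rw [← NNReal.tendsto_coe]
  have h : ∀ N : ℕ, (overlapWeight (c / N) N : ℝ)
      = ((1 + (c : ℝ) / N) ^ N) ^ 2 - (1 + (2 * c : ℝ) / N) ^ N := fun N => by
    have := congrArg ((↑) : ℝ≥0 → ℝ) (overlapWeight_add (c / N) N)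
    push_cast at this
    rw [← this, mul_div_assoc]
    ring
  simp_rw [h]
  have := ((Real.tendsto_one_add_div_pow_exp (c : ℝ)).pow 2).sub
    (Real.tendsto_one_add_div_pow_exp (2 * c : ℝ))
  have h0 : Real.exp (c : ℝ) ^ 2 - Real.exp (2 * c : ℝ) = ((0 : ℝ≥0) : ℝ) := by
    rw [← Real.exp_nat_mul]; simp
  rwa [h0] at this

lemma choose_mul_pow_le (c : ℝ≥0) {N m : ℕ} (hm : m ≤ N) (k : ℕ) :
    m.choose k * (c / N) ^ k ≤ poissonWeight c k := by
  rcases Nat.eq_zero_or_pos N with rfl | hN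
  · obtain rfl : m = 0 := by omega
    cases k <;> simp [poissonWeight]
  have hN' : (0 : ℝ≥0) < N := by exact_mod_cast hN
  calc (m.choose k : ℝ≥0) * (c / N) ^ k
      ≤ (N : ℝ≥0) ^ k / k.factorial * (c / N) ^ k := by
        refine mul_le_mul_left ((Nat.choose_le_pow_div k m).trans ?_) _
        gcongr
    _ = poissonWeight c k := by
        rw [poissonWeight, div_pow]
        field_simp

/-- Being valid for every `N`, this bounds the larger side of the inequality without any exchange of
limit and sum. -/
lemma pairWeight_le (c : ℝ≥0) (N k l : ℕ) :
    pairWeight (c / N) N k l ≤ poissonWeight c k * poissonWeight c l :=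
  mul_le_mul' (choose_mul_pow_le c le_rfl k) (choose_mul_pow_le c (Nat.sub_le N k) l)

lemma tendsto_pairWeight (c : ℝ≥0) (k l : ℕ) :
    Tendsto (fun N : ℕ => pairWeight (c / N) N k l) atTop
      (𝓝 (poissonWeight c k * poissonWeight c l)) := by
  have key : ∀ k l : ℕ, Tendsto (fun N : ℕ => ((N - k).choose l * (c / N) ^ l : ℝ≥0)) atTop
      (𝓝 (poissonWeight c l)) := fun k l => by
    -- Shifting `N` by `k` turns the truncated `N - k` into the running variable.
    rw [← tendsto_add_atTop_iff_nat k, ← NNReal.tendsto_coe]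
    have hp : Tendsto (fun n : ℕ => (n : ℝ) * (c / ((n + k : ℕ) : ℝ))) atTop (𝓝 (c : ℝ)) := by
      have := (tendsto_natCast_div_add_atTop (𝕜 := ℝ) (k : ℝ)).mul_const (c : ℝ)
      rw [one_mul] at this
      refine this.congr fun n => ?_
      push_cast
      ring
    have := tendsto_choose_mul_pow_atTop l hp
    simpa [poissonWeight] using this
  have := (key 0 k).mul (key k l)
  simpa [pairWeight] using this

lemma flipSum_eq {β : ℝ} {N : ℕ} (r : ℝ≥0) (u : Fin N → ℝ) (F : SpinPath β → ℝ≥0) :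
    flipSum r u F = ∑ S : Finset (Fin N), r ^ S.card * ∑ b, F (subPath β b u S) := by
  rw [flipSum, Fintype.sum_prod_type_right]
  simp_rw [Finset.mul_sum]

lemma measurable_sum_subPath {β : ℝ} {F : SpinPath β → ℝ≥0} (hF : Measurable F) {N : ℕ}
    (S : Finset (Fin N)) : Measurable fun u => ∑ b, F (subPath β b u S) :=
  (measurable_sum_flipPath hF S.card).comp
    (measurable_pi_lambda _ fun j => measurable_pi_apply (S.orderEmbOfFin rfl j))

lemma lintegral_flipSum_mul {β : ℝ} {F F' : SpinPath β → ℝ≥0} (hF : Measurable F)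
    (hF' : Measurable F') (r : ℝ≥0) (N : ℕ) :
    ∫⁻ u, ((flipSum r u F * flipSum r u F' : ℝ≥0) : ℝ≥0∞)
        ∂(Measure.pi fun _ : Fin N => uniformTime β)
      = ∑ S : Finset (Fin N), ∑ S' : Finset (Fin N), ((r ^ S.card * r ^ S'.card : ℝ≥0) : ℝ≥0∞) *
        ∫⁻ u, ((∑ b, F (subPath β b u S) : ℝ≥0) : ℝ≥0∞) *
          ((∑ b, F' (subPath β b u S') : ℝ≥0) : ℝ≥0∞)
          ∂(Measure.pi fun _ : Fin N => uniformTime β) := by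
  have hm : ∀ S S' : Finset (Fin N), Measurable fun u =>
      ((∑ b, F (subPath β b u S) : ℝ≥0) : ℝ≥0∞) * ((∑ b, F' (subPath β b u S') : ℝ≥0) : ℝ≥0∞) :=
    fun S S' => (measurable_sum_subPath hF S).coe_nnreal_ennreal.mul
      (measurable_sum_subPath hF' S').coe_nnreal_ennreal
  have h : ∀ u : Fin N → ℝ, ((flipSum r u F * flipSum r u F' : ℝ≥0) : ℝ≥0∞)
      = ∑ S : Finset (Fin N), ∑ S' : Finset (Fin N), ((r ^ S.card * r ^ S'.card : ℝ≥0) : ℝ≥0∞) *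
        (((∑ b, F (subPath β b u S) : ℝ≥0) : ℝ≥0∞) *
          ((∑ b, F' (subPath β b u S') : ℝ≥0) : ℝ≥0∞)) := fun u => by
    rw [flipSum_eq, flipSum_eq, Finset.sum_mul_sum]
    push_cast
    refine Finset.sum_congr rfl fun S _ => Finset.sum_congr rfl fun S' _ => ?_
    ring
  simp_rw [h]
  rw [lintegral_finsetSum _ fun S _ => Finset.measurable_sum _ fun S' _ => (hm S S').const_mul _]
  refine Finset.sum_congr rfl fun S _ => ?_
  rw [lintegral_finsetSum _ fun S' _ => (hm S S').const_mul _]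
  refine Finset.sum_congr rfl fun S' _ => ?_
  rw [lintegral_const_mul _ (hm S S')]

/-- The lower bound discards the overlapping pairs, whose contribution is nonnegative. -/
lemma le_lintegral_flipSum_mul {β : ℝ} (hβ : 0 < β) {F F' : SpinPath β → ℝ≥0} (hF : Measurable F)
    (hF' : Measurable F') (r : ℝ≥0) (N : ℕ) :
    ∑' k, ∑' l, (pairWeight r N k l : ℝ≥0∞) * (flipMean β F k * flipMean β F' l)
      ≤ ∫⁻ u, ((flipSum r u F * flipSum r u F' : ℝ≥0) : ℝ≥0∞)
        ∂(Measure.pi fun _ : Fin N => uniformTime β) := by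
  rw [← sum_disjoint_pairs, lintegral_flipSum_mul hF hF']
  refine Finset.sum_le_sum fun S _ => Finset.sum_le_sum fun S' _ => ?_
  split_ifs with h
  · rw [lintegral_subPath_mul hβ hF hF' h]
  · exact zero_le

/-- The upper bound keeps the overlapping pairs, each sum over the initial sign being at most `2 *
M`. -/
lemma lintegral_flipSum_mul_le {β : ℝ} (hβ : 0 < β) {F F' : SpinPath β → ℝ≥0} (hF : Measurable F)
    (hF' : Measurable F') {M : ℝ≥0} (hM : ∀ s, F s ≤ M) (hM' : ∀ s, F' s ≤ M) (r : ℝ≥0) (N : ℕ) :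
    ∫⁻ u, ((flipSum r u F * flipSum r u F' : ℝ≥0) : ℝ≥0∞)
        ∂(Measure.pi fun _ : Fin N => uniformTime β)
      ≤ ∑' k, ∑' l, (pairWeight r N k l : ℝ≥0∞) * (flipMean β F k * flipMean β F' l)
        + ((overlapWeight r N * (2 * M) ^ 2 : ℝ≥0) : ℝ≥0∞) := by
  have := isProbabilityMeasure_uniformTime hβ
  have hb : ∀ {F : SpinPath β → ℝ≥0}, (∀ s, F s ≤ M) → ∀ (u : Fin N → ℝ) (S : Finset (Fin N)),
      ∑ b, F (subPath β b u S) ≤ 2 * M := fun hM u S =>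
    (Finset.sum_le_sum fun b _ => hM _).trans_eq (by simp)
  rw [← sum_disjoint_pairs, lintegral_flipSum_mul hF hF', overlapWeight, Finset.sum_mul,
    ENNReal.ofNNReal_finsetSum, ← Finset.sum_add_distrib]
  refine Finset.sum_le_sum fun S _ => ?_
  rw [Finset.sum_mul, ENNReal.ofNNReal_finsetSum, ← Finset.sum_add_distrib]
  refine Finset.sum_le_sum fun S' _ => ?_
  split_ifs with h
  · rw [lintegral_subPath_mul hβ hF hF' h]
    simp
  · rw [zero_add, ENNReal.coe_mul (r ^ S.card * r ^ S'.card) ((2 * M) ^ 2)]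
    gcongr
    calc _ ≤ ∫⁻ _, (((2 * M) ^ 2 : ℝ≥0) : ℝ≥0∞) ∂(Measure.pi fun _ : Fin N => uniformTime β) := by
          refine lintegral_mono fun u => ?_
          rw [sq, ENNReal.coe_mul]
          exact mul_le_mul' (ENNReal.coe_le_coe.2 (hb hM u S)) (ENNReal.coe_le_coe.2 (hb hM' u S'))
      _ = _ := by simp

/-- The hypothesis at `r = c / N` is integrated over `N` independent uniform points. On the left it
suffices to pass to the limit in finite partial sums; the right side is at most `R` plus an overlap
error tending to zero. -/
lemma tsum_poissonWeight_mul_le {β : ℝ} (hβ : 0 < β) (c : ℝ≥0) {F₁ F₂ F₃ F₄ : SpinPath β → ℝ≥0}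
    (h1 : Measurable F₁) (h2 : Measurable F₂) (h3 : Measurable F₃) (h4 : Measurable F₄) {M : ℝ≥0}
    (hM1 : ∀ s, F₁ s ≤ M) (hM2 : ∀ s, F₂ s ≤ M) (hM3 : ∀ s, F₃ s ≤ M) (hM4 : ∀ s, F₄ s ≤ M)
    (h : ∀ (N : ℕ) (u : Fin N → ℝ) (r : ℝ≥0), r ≤ 1 →
      flipSum r u F₁ * flipSum r u F₂ ≤ flipSum r u F₃ * flipSum r u F₄) :
    (∑' n, (poissonWeight c n : ℝ≥0∞) * flipMean β F₁ n) *
        ∑' n, (poissonWeight c n : ℝ≥0∞) * flipMean β F₂ n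
      ≤ (∑' n, (poissonWeight c n : ℝ≥0∞) * flipMean β F₃ n) *
        ∑' n, (poissonWeight c n : ℝ≥0∞) * flipMean β F₄ n := by
  set R := (∑' n, (poissonWeight c n : ℝ≥0∞) * flipMean β F₃ n) *
        ∑' n, (poissonWeight c n : ℝ≥0∞) * flipMean β F₄ n with hR
  have hup : ∀ N : ℕ, ∑' k, ∑' l, (pairWeight (c / N) N k l : ℝ≥0∞) *
      (flipMean β F₃ k * flipMean β F₄ l) ≤ R := fun N => by
    rw [hR, ← ENNReal.tsum_mul_right]
    refine ENNReal.tsum_le_tsum fun k => ?_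
    rw [← ENNReal.tsum_mul_left]
    refine ENNReal.tsum_le_tsum fun l => ?_
    calc _ ≤ ((poissonWeight c k * poissonWeight c l : ℝ≥0) : ℝ≥0∞) *
          (flipMean β F₃ k * flipMean β F₄ l) := by
          gcongr
          exact pairWeight_le c N k l
      _ = _ := by push_cast; ring
  have hlim : Tendsto (fun N : ℕ => R + ((overlapWeight (c / N) N * (2 * M) ^ 2 : ℝ≥0) : ℝ≥0∞))
      atTop (𝓝 R) := by
    have : Tendsto (fun N : ℕ => overlapWeight (c / N) N * (2 * M) ^ 2) atTop (𝓝 0) := by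
      simpa using (tendsto_overlapWeight c).mul_const ((2 * M) ^ 2)
    have h0 := (ENNReal.tendsto_coe.2 this).const_add R
    simpa using h0
  have hfin : ∀ K L : ℕ,
      (∑ k ∈ Finset.range K, (poissonWeight c k : ℝ≥0∞) * flipMean β F₁ k) *
        ∑ l ∈ Finset.range L, (poissonWeight c l : ℝ≥0∞) * flipMean β F₂ l ≤ R := by
    intro K L
    have hl : Tendsto (fun N : ℕ => ∑ k ∈ Finset.range K, ∑ l ∈ Finset.range L,
        (pairWeight (c / N) N k l : ℝ≥0∞) * (flipMean β F₁ k * flipMean β F₂ l)) atTop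
        (𝓝 ((∑ k ∈ Finset.range K, (poissonWeight c k : ℝ≥0∞) * flipMean β F₁ k) *
        ∑ l ∈ Finset.range L, (poissonWeight c l : ℝ≥0∞) * flipMean β F₂ l)) := by
      rw [Finset.sum_mul_sum]
      refine tendsto_finsetSum _ fun k _ => tendsto_finsetSum _ fun l _ => ?_
      have h5 := ENNReal.Tendsto.mul_const (b := flipMean β F₁ k * flipMean β F₂ l)
        (ENNReal.tendsto_coe.2 (tendsto_pairWeight c k l)) (Or.inr (ENNReal.mul_ne_top
          ((flipMean_le hβ hM1 k).trans_lt ENNReal.coe_lt_top).ne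
          ((flipMean_le hβ hM2 l).trans_lt ENNReal.coe_lt_top).ne))
      convert h5 using 2
      push_cast
      ring
    refine le_of_tendsto_of_tendsto hl hlim ?_
    -- From this `N` on, `c / N ≤ 1`, as the lattice condition requires.
    filter_upwards [eventually_ge_atTop ⌈c⌉₊] with N hN
    have hr : c / N ≤ 1 := div_le_one_of_le₀ ((Nat.le_ceil c).trans (by exact_mod_cast hN)) zero_le
    calc _ ≤ ∑' k, ∑' l, (pairWeight (c / N) N k l : ℝ≥0∞) *
            (flipMean β F₁ k * flipMean β F₂ l) :=
          (Finset.sum_le_sum fun k _ => ENNReal.sum_le_tsum _).trans (ENNReal.sum_le_tsum _)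
      _ ≤ _ := le_lintegral_flipSum_mul hβ h1 h2 _ N
      _ ≤ ∫⁻ u, ((flipSum (c / N) u F₃ * flipSum (c / N) u F₄ : ℝ≥0) : ℝ≥0∞)
        ∂(Measure.pi fun _ : Fin N => uniformTime β) :=
          lintegral_mono fun u => ENNReal.coe_le_coe.2 (h N u _ hr)
      _ ≤ _ := lintegral_flipSum_mul_le hβ h3 h4 hM3 hM4 _ N
      _ ≤ _ := by gcongr; exact hup N
  rw [ENNReal.tsum_eq_iSup_nat, ENNReal.tsum_eq_iSup_nat, ENNReal.iSup_mul]
  refine iSup_le fun K => ?_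
  rw [ENNReal.mul_iSup]
  exact iSup_le fun L => hfin K L

lemma abs_dot_le {β : ℝ} (k : Icc (0 : ℝ) β → ℝ) (s : SpinPath β) :
    |dot k s.1| ≤ ∫ t, |k t| ∂(timeMeasure β) := by
  refine (abs_integral_le_integral_abs).trans_eq ?_
  simp [abs_mul, abs_path]

lemma measurable_fieldWeight {β : ℝ} (k : Icc (0 : ℝ) β → ℝ) : Measurable (fieldWeight k) :=
  (Real.measurable_exp.comp (measurable_dot_field k)).real_toNNReal

lemma exists_fieldWeight_le {β : ℝ} (k : Icc (0 : ℝ) β → ℝ) : ∃ M : ℝ≥0, ∀ s, fieldWeight k s ≤ M :=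
  ⟨(Real.exp (∫ t, |k t| ∂(timeMeasure β))).toNNReal, fun s =>
    Real.toNNReal_le_toNNReal (Real.exp_le_exp.2 ((le_abs_self _).trans (abs_dot_le k s)))⟩

lemma freeLaw_fkg_of_bounded {β : ℝ} (hβ : 0 < β) (lam : ℝ≥0) {k : Icc (0 : ℝ) β → ℝ}
    (hk : Integrable k (timeMeasure β)) {f g : SpinPath β → ℝ≥0} (hf : Measurable f)
    (hg : Measurable g) (hfm : PathMono f) (hgm : PathMono g) {M : ℝ≥0} (hfM : ∀ s, f s ≤ M)
    (hgM : ∀ s, g s ≤ M) :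
    (∫⁻ s, fieldWeight k s * f s ∂(freeLaw β lam)) * ∫⁻ s, fieldWeight k s * g s ∂(freeLaw β lam)
      ≤ (∫⁻ s, fieldWeight k s ∂(freeLaw β lam)) *
        ∫⁻ s, fieldWeight k s * (f s * g s) ∂(freeLaw β lam) := by
  obtain ⟨C, hC⟩ := exists_fieldWeight_le k
  have hw := measurable_fieldWeight k
  -- One constant dominating all four integrands, which are at most `C * M`, `C * M`, `C` and `C *
  -- (M * M)`.
  have key := tsum_poissonWeight_mul_le (M := C * (M + M * M + 1)) hβ (lam * β.toNNReal)
    (hw.mul hf) (hw.mul hg) hw (hw.mul (hf.mul hg))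
    (fun s => mul_le_mul' (hC s) ((hfM s).trans (by rw [add_assoc]; exact le_self_add)))
    (fun s => mul_le_mul' (hC s) ((hgM s).trans (by rw [add_assoc]; exact le_self_add)))
    (fun s => (hC s).trans (le_mul_of_one_le_right zero_le le_add_self))
    (fun s => mul_le_mul' (hC s) ((mul_le_mul' (hfM s) (hgM s)).trans
      (by rw [add_right_comm]; exact le_add_self)))
    (fun N u r hr => flipSum_fkg hk u hr hfm hgm)
  have h1 := lintegral_freeLaw lam (hw.mul hf)
  have h2 := lintegral_freeLaw lam (hw.mul hg)
  have h3 := lintegral_freeLaw lam hw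
  have h4 := lintegral_freeLaw lam (hw.mul (hf.mul hg))
  simp only [Pi.mul_apply, ENNReal.coe_mul] at h1 h2 h4
  rw [h1, h2, h3, h4]
  calc _ = _ * _ * (_ * _) := mul_mul_mul_comm _ _ _ _
    _ ≤ _ * _ * (_ * _) := mul_le_mul_right key _
    _ = _ := (mul_mul_mul_comm _ _ _ _).symm

lemma iSup_min_natCast (x : ℝ≥0∞) : ⨆ n : ℕ, min x n = x := by
  rw [← inf_iSup_eq, ENNReal.iSup_natCast, inf_top_eq]

lemma lintegral_mul_eq_iSup_min {Ω : Type*} [MeasurableSpace Ω] {m : Measure Ω} {w : Ω → ℝ≥0}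
    (hw : Measurable w) {f : Ω → ℝ≥0∞} (hf : Measurable f) :
    ∫⁻ s, w s * f s ∂m = ⨆ n : ℕ, ∫⁻ s, w s * min (f s) n ∂m := by
  rw [← lintegral_iSup]
  · simp_rw [← ENNReal.mul_iSup, iSup_min_natCast]
  · exact fun n => hw.coe_nnreal_ennreal.mul (hf.min measurable_const)
  · intro n m hnm s
    have : (n : ℝ≥0∞) ≤ m := by exact_mod_cast hnm
    dsimp only
    gcongr

/-- The **FKG inequality** for a single spin in a field. -/
theorem freeLaw_fkg {β : ℝ} (hβ : 0 < β) (lam : ℝ≥0) {k : Icc (0 : ℝ) β → ℝ}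
    (hk : Integrable k (timeMeasure β)) {f g : SpinPath β → ℝ≥0∞} (hf : Measurable f)
    (hg : Measurable g) (hfm : PathMono f) (hgm : PathMono g) :
    (∫⁻ s, fieldWeight k s * f s ∂(freeLaw β lam)) * ∫⁻ s, fieldWeight k s * g s ∂(freeLaw β lam)
      ≤ (∫⁻ s, fieldWeight k s ∂(freeLaw β lam)) *
        ∫⁻ s, fieldWeight k s * (f s * g s) ∂(freeLaw β lam) := by
  have hw := measurable_fieldWeight k
  rw [lintegral_mul_eq_iSup_min hw hf, lintegral_mul_eq_iSup_min hw hg, ENNReal.iSup_mul]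
  refine iSup_le fun n => ?_
  rw [ENNReal.mul_iSup]
  refine iSup_le fun m => ?_
  have hcoe : ∀ (x : ℝ≥0∞) (n : ℕ), ((min x n).toNNReal : ℝ≥0∞) = min x n := fun x n =>
    ENNReal.coe_toNNReal (ne_top_of_le_ne_top (ENNReal.natCast_ne_top n) (min_le_right _ _))
  have hmono : ∀ {f : SpinPath β → ℝ≥0∞}, PathMono f → ∀ n : ℕ,
      PathMono fun s => (min (f s) n).toNNReal := fun hfm n σ τ hστ => by
    rw [← ENNReal.coe_le_coe, hcoe, hcoe]
    exact min_le_min_right _ (hfm σ τ hστ)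
  have hle : ∀ (f : SpinPath β → ℝ≥0∞) {n p : ℕ}, n ≤ p → ∀ s, (min (f s) n).toNNReal ≤ (p : ℝ≥0) :=
    fun f n p hnp s => by
      rw [← ENNReal.coe_le_coe, hcoe]
      exact (min_le_right _ _).trans (by exact_mod_cast hnp)
  have key := freeLaw_fkg_of_bounded hβ lam hk (hf.min measurable_const).ennreal_toNNReal
    (hg.min measurable_const).ennreal_toNNReal (hmono hfm n) (hmono hgm m)
    (hle f (le_max_left n m)) (hle g (le_max_right n m))
  simp only [hcoe] at key
  refine key.trans ?_
  gcongr <;> exact min_le_left _ _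

/-! ### Single spins in a field -/

lemma coe_fieldWeight {β : ℝ} (k : Icc (0 : ℝ) β → ℝ) (s : SpinPath β) :
    (fieldWeight k s : ℝ≥0∞) = ENNReal.ofReal (Real.exp (dot k s.1)) := rfl

lemma integrable_exp_dot {β : ℝ} (k : Icc (0 : ℝ) β → ℝ) (m : Measure (SpinPath β))
    [IsFiniteMeasure m] : Integrable (fun s : SpinPath β => Real.exp (dot k s.1)) m :=
  Integrable.of_bound (Real.measurable_exp.comp (measurable_dot_field k)).aestronglyMeasurable
    (Real.exp (∫ t, |k t| ∂(timeMeasure β))) (Eventually.of_forall fun s => by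
      rw [Real.norm_eq_abs, Real.abs_exp]
      exact Real.exp_le_exp.2 ((le_abs_self _).trans (abs_dot_le k s)))

lemma lintegral_fieldWeight_ne_top {β : ℝ} (k : Icc (0 : ℝ) β → ℝ) (m : Measure (SpinPath β))
    [IsFiniteMeasure m] : ∫⁻ s, fieldWeight k s ∂m ≠ ∞ := by
  simp only [coe_fieldWeight]
  rw [← ofReal_integral_eq_lintegral_ofReal (integrable_exp_dot k m)
    (Eventually.of_forall fun s => (Real.exp_pos _).le)]
  exact ENNReal.ofReal_ne_top

lemma lintegral_fieldWeight_ne_zero {β : ℝ} (k : Icc (0 : ℝ) β → ℝ) (m : Measure (SpinPath β))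
    [IsProbabilityMeasure m] : ∫⁻ s, fieldWeight k s ∂m ≠ 0 := by
  simp only [coe_fieldWeight]
  rw [← ofReal_integral_eq_lintegral_ofReal (integrable_exp_dot k m)
    (Eventually.of_forall fun s => (Real.exp_pos _).le)]
  have := integral_exp_pos (integrable_exp_dot k m)
  simpa using this

lemma lintegral_tilted_dot {β : ℝ} (k : Icc (0 : ℝ) β → ℝ) (m : Measure (SpinPath β))
    [IsProbabilityMeasure m] {F : SpinPath β → ℝ≥0∞} (hF : Measurable F) :
    ∫⁻ s, F s ∂(m.tilted fun s => dot k s.1)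
      = (∫⁻ s, fieldWeight k s ∂m)⁻¹ * ∫⁻ s, fieldWeight k s * F s ∂m := by
  have hpos := integral_exp_pos (integrable_exp_dot k m)
  rw [lintegral_tilted, ← lintegral_const_mul _
    ((measurable_fieldWeight k).coe_nnreal_ennreal.fun_mul hF)]
  refine lintegral_congr fun s => ?_
  simp only [coe_fieldWeight]
  rw [← ofReal_integral_eq_lintegral_ofReal (integrable_exp_dot k m)
    (Eventually.of_forall fun s => (Real.exp_pos _).le), ENNReal.ofReal_div_of_pos hpos,
    ENNReal.div_eq_inv_mul, mul_assoc]

lemma freeLaw_tilted_fkg {β : ℝ} (hβ : 0 < β) (lam : ℝ≥0) {k : Icc (0 : ℝ) β → ℝ}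
    (hk : Integrable k (timeMeasure β)) {f g : SpinPath β → ℝ≥0∞} (hf : Measurable f)
    (hg : Measurable g) (hfm : PathMono f) (hgm : PathMono g) :
    (∫⁻ s, f s ∂((freeLaw β lam).tilted fun s => dot k s.1)) *
        ∫⁻ s, g s ∂((freeLaw β lam).tilted fun s => dot k s.1)
      ≤ ∫⁻ s, f s * g s ∂((freeLaw β lam).tilted fun s => dot k s.1) := by
  have := isProbabilityMeasure_freeLaw hβ lam
  rw [lintegral_tilted_dot k _ hf, lintegral_tilted_dot k _ hg, lintegral_tilted_dot k _ (hf.fun_mul hg)]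
  set Z := ∫⁻ s, fieldWeight k s ∂(freeLaw β lam) with hZ
  have hZ0 : Z ≠ 0 := lintegral_fieldWeight_ne_zero k _
  have hZt : Z ≠ ∞ := lintegral_fieldWeight_ne_top k _
  calc _ = Z⁻¹ * (Z⁻¹ * ((∫⁻ s, fieldWeight k s * f s ∂(freeLaw β lam)) *
          ∫⁻ s, fieldWeight k s * g s ∂(freeLaw β lam))) := by ring
    _ ≤ Z⁻¹ * (Z⁻¹ * (Z * ∫⁻ s, fieldWeight k s * (f s * g s) ∂(freeLaw β lam))) := by
        exact mul_le_mul_right (mul_le_mul_right (freeLaw_fkg hβ lam hk hf hg hfm hgm) _) _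
    _ = _ := by
        rw [← mul_assoc Z⁻¹ Z, ENNReal.inv_mul_cancel hZ0 hZt, one_mul]

/-- The weight of the field `k'` is the weight of `k` times `exp ((k' - k) • s)`, which is
increasing in `s` because `k ≤ k'`. The claim is positive association of `f` with this factor in the
field `k`. -/
lemma freeLaw_tilted_mono {β : ℝ} (hβ : 0 < β) (lam : ℝ≥0) {k k' : Icc (0 : ℝ) β → ℝ}
    (hk : Integrable k (timeMeasure β)) (hk' : Integrable k' (timeMeasure β))
    (hkk : k ≤ᵐ[timeMeasure β] k') {f : SpinPath β → ℝ≥0∞} (hf : Measurable f)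
    (hfm : PathMono f) :
    ∫⁻ s, f s ∂((freeLaw β lam).tilted fun s => dot k s.1)
      ≤ ∫⁻ s, f s ∂((freeLaw β lam).tilted fun s => dot k' s.1) := by
  have := isProbabilityMeasure_freeLaw hβ lam
  have hdm : PathMono fun s => (fieldWeight (k' - k) s : ℝ≥0∞) := by
    intro σ τ hστ
    refine ENNReal.coe_le_coe.2 (Real.toNNReal_le_toNNReal (Real.exp_le_exp.2 ?_))
    refine integral_mono_ae (integrable_mul_path (hk'.sub hk) σ)
      (integrable_mul_path (hk'.sub hk) τ) ?_
    filter_upwards [hkk, hστ] with t h1 h2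
    exact mul_le_mul_of_nonneg_left h2 (sub_nonneg.2 h1)
  have hw : ∀ s, (fieldWeight k' s : ℝ≥0∞) = fieldWeight k s * fieldWeight (k' - k) s := fun s => by
    rw [coe_fieldWeight, coe_fieldWeight, coe_fieldWeight,
      ← ENNReal.ofReal_mul (Real.exp_pos _).le, ← Real.exp_add]
    congr 2
    simp only [dot]
    rw [← integral_add (integrable_mul_path hk s) (integrable_mul_path (hk'.sub hk) s)]
    congr 1
    funext t
    simp only [Pi.sub_apply]
    ring
  have key := freeLaw_fkg hβ lam hk hf (measurable_fieldWeight (k' - k)).coe_nnreal_ennreal hfm hdm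
  rw [lintegral_tilted_dot k _ hf, lintegral_tilted_dot k' _ hf]
  have h1 : ∀ s, (fieldWeight k s : ℝ≥0∞) * (f s * fieldWeight (k' - k) s)
      = fieldWeight k' s * f s := fun s => by rw [hw]; ring
  simp_rw [h1, ← hw] at key
  set Z := ∫⁻ s, fieldWeight k s ∂(freeLaw β lam)
  set Z' := ∫⁻ s, fieldWeight k' s ∂(freeLaw β lam)
  have hZ0 : Z ≠ 0 := lintegral_fieldWeight_ne_zero k _
  have hZt : Z ≠ ∞ := lintegral_fieldWeight_ne_top k _
  have hZ0' : Z' ≠ 0 := lintegral_fieldWeight_ne_zero k' _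
  have hZt' : Z' ≠ ∞ := lintegral_fieldWeight_ne_top k' _
  calc _ = Z⁻¹ * Z'⁻¹ * ((∫⁻ s, fieldWeight k s * f s ∂(freeLaw β lam)) * Z') := by
        rw [mul_comm _ Z', mul_assoc, ← mul_assoc Z'⁻¹, ENNReal.inv_mul_cancel hZ0' hZt', one_mul]
    _ ≤ Z⁻¹ * Z'⁻¹ * (Z * ∫⁻ s, fieldWeight k' s * f s ∂(freeLaw β lam)) := by gcongr
    _ = _ := by
        rw [mul_comm Z⁻¹, mul_assoc, ← mul_assoc Z⁻¹, ENNReal.inv_mul_cancel hZ0 hZt, one_mul]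

/-! ### The heat bath updates -/

section Sites

variable {V : Type*} [Fintype V] [DecidableEq V] (G : SimpleGraph V) [DecidableRel G.Adj]
  {β : ℝ} (h : V → Icc (0 : ℝ) β → ℝ) (lam : ℝ≥0)

/-- The order on configurations: `σ_x ≤ τ_x` almost everywhere for every `x`. -/
def ConfigLE (σ τ : Config V β) : Prop := ∀ x, PathLE (σ x) (τ x)

/-- Increasing functions of the configuration with values in `[0, ∞]`. -/
def ConfigMono (f : Config V β → ℝ≥0∞) : Prop := ∀ σ τ, ConfigLE σ τ → f σ ≤ f τ

/-- The field `h_x + ∑_{y ∼ x} ρ_y`. -/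
def siteField (x : V) (ρ : Config V β) (t : Icc (0 : ℝ) β) : ℝ :=
  h x t + ∑ y ∈ G.neighborFinset x, (ρ y).1 t

lemma integrable_path (s : SpinPath β) : Integrable s.1 (timeMeasure β) := by
  simpa using integrable_mul_path (integrable_const (1 : ℝ)) s

lemma integrable_siteField {x : V} (hx : Integrable (h x) (timeMeasure β)) (ρ : Config V β) :
    Integrable (siteField G h x ρ) (timeMeasure β) :=
  hx.add (integrable_finsetSum _ fun y _ => integrable_path (ρ y))

lemma dot_siteField {x : V} (hx : Integrable (h x) (timeMeasure β)) (ρ : Config V β)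
    (s : SpinPath β) : dot (siteField G h x ρ) s.1
      = dot (h x) s.1 + ∑ y ∈ G.neighborFinset x, dot (ρ y).1 s.1 := by
  have h1 : ∀ y, Integrable (fun t => (ρ y).1 t * s.1 t) (timeMeasure β) := fun y =>
    integrable_mul_path (integrable_path _) s
  simp only [dot, siteField, add_mul, Finset.sum_mul]
  rw [integral_add (integrable_mul_path hx s) (integrable_finsetSum _ fun y _ => h1 y),
    integral_finsetSum _ fun y _ => h1 y]

/-- The neighbours act only through one integrable field, so the results on a single spin apply to
every site law. -/
lemma siteLaw_eq_tilted {x : V} (hx : Integrable (h x) (timeMeasure β)) (ρ : Config V β) :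
    siteLaw G β h lam x ρ = (freeLaw β lam).tilted fun s => dot (siteField G h x ρ) s.1 := by
  simp_rw [dot_siteField G h hx]
  rfl

lemma isProbabilityMeasure_siteLaw (hβ : 0 < β) {x : V} (hx : Integrable (h x) (timeMeasure β))
    (ρ : Config V β) : IsProbabilityMeasure (siteLaw G β h lam x ρ) := by
  have := isProbabilityMeasure_freeLaw hβ lam
  rw [siteLaw_eq_tilted G h lam hx]
  exact isProbabilityMeasure_tilted (integrable_exp_dot _ _)

lemma isMarkovKernel_heatBath (hβ : 0 < β) {x : V} (hx : Integrable (h x) (timeMeasure β)) :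
    IsMarkovKernel (heatBath G β h lam x) := ⟨fun ρ => by
  have := isProbabilityMeasure_siteLaw G h lam hβ hx ρ
  exact Measure.isProbabilityMeasure_map (measurable_update ρ).aemeasurable⟩

lemma lintegral_heatBath (x : V) (ρ : Config V β) {F : Config V β → ℝ≥0∞} (hF : Measurable F) :
    ∫⁻ σ, F σ ∂(heatBath G β h lam x ρ)
      = ∫⁻ s, F (Function.update ρ x s) ∂(siteLaw G β h lam x ρ) :=
  lintegral_map hF (measurable_update ρ)

lemma siteField_update (x : V) (ρ : Config V β) (s : SpinPath β) :
    siteField G h x (Function.update ρ x s) = siteField G h x ρ := by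
  funext t
  refine congrArg (h x t + ·) (Finset.sum_congr rfl fun y hy => ?_)
  have : y ≠ x := fun hyx => G.loopless.irrefl x (by simp [hyx] at hy)
  rw [Function.update_of_ne this]

lemma siteLaw_update {x : V} (hx : Integrable (h x) (timeMeasure β)) (ρ : Config V β)
    (s : SpinPath β) :
    siteLaw G β h lam x (Function.update ρ x s) = siteLaw G β h lam x ρ := by
  rw [siteLaw_eq_tilted G h lam hx, siteLaw_eq_tilted G h lam hx, siteField_update]

/-- The update forgets the spin at `x`: the site law depends only on the neighbours, and `x` is not
its own neighbour. Hence `μ_x(F)` is constant in that coordinate. -/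
lemma lintegral_heatBath_update {x : V} (hx : Integrable (h x) (timeMeasure β)) (ρ : Config V β)
    (s : SpinPath β) {F : Config V β → ℝ≥0∞} (hF : Measurable F) :
    ∫⁻ σ, F σ ∂(heatBath G β h lam x (Function.update ρ x s))
      = ∫⁻ σ, F σ ∂(heatBath G β h lam x ρ) := by
  rw [lintegral_heatBath G h lam x _ hF, lintegral_heatBath G h lam x _ hF,
    siteLaw_update G h lam hx]
  simp

lemma pathMono_update {f : Config V β → ℝ≥0∞} (hf : ConfigMono f) (x : V) (ρ : Config V β) :
    PathMono fun s => f (Function.update ρ x s) := by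
  intro σ τ hστ
  refine hf _ _ fun y => ?_
  by_cases hy : y = x
  · subst hy; simpa using hστ
  · simp only [Function.update_of_ne hy]
    exact Eventually.of_forall fun t => le_rfl

/-- Two increases in turn: the spins off `x` are raised inside `f` under a fixed site law, then the
field is raised and `freeLaw_tilted_mono` applies. -/
lemma configMono_heatBath (hβ : 0 < β) {x : V} (hx : Integrable (h x) (timeMeasure β))
    {f : Config V β → ℝ≥0∞} (hf : Measurable f) (hfm : ConfigMono f) :
    ConfigMono fun ρ => ∫⁻ σ, f σ ∂(heatBath G β h lam x ρ) := by
  intro ρ ρ' hρ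
  simp only [lintegral_heatBath G h lam x _ hf]
  have hfield : siteField G h x ρ ≤ᵐ[timeMeasure β] siteField G h x ρ' := by
    have : ∀ᵐ t ∂(timeMeasure β), ∀ y, (ρ y).1 t ≤ (ρ' y).1 t := ae_all_iff.2 hρ
    filter_upwards [this] with t ht
    exact add_le_add le_rfl (Finset.sum_le_sum fun y _ => ht y)
  calc _ ≤ ∫⁻ s, f (Function.update ρ' x s) ∂(siteLaw G β h lam x ρ) := by
        refine lintegral_mono fun s => hfm _ _ fun y => ?_
        by_cases hy : y = x
        · subst hy; simp only [Function.update_self]; exact Eventually.of_forall fun t => le_rfl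
        · simp only [Function.update_of_ne hy]; exact hρ y
    _ ≤ _ := by
        rw [siteLaw_eq_tilted G h lam hx, siteLaw_eq_tilted G h lam hx]
        exact freeLaw_tilted_mono hβ lam (integrable_siteField G h hx ρ)
          (integrable_siteField G h hx ρ') hfield (hf.comp (measurable_update ρ'))
          (pathMono_update hfm x ρ')

lemma lintegral_heatBath_mul_le (hβ : 0 < β) {x : V} (hx : Integrable (h x) (timeMeasure β))
    {f g : Config V β → ℝ≥0∞} (hf : Measurable f) (hg : Measurable g) (hfm : ConfigMono f)
    (hgm : ConfigMono g) (ρ : Config V β) :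
    (∫⁻ σ, f σ ∂(heatBath G β h lam x ρ)) * ∫⁻ σ, g σ ∂(heatBath G β h lam x ρ)
      ≤ ∫⁻ σ, f σ * g σ ∂(heatBath G β h lam x ρ) := by
  rw [lintegral_heatBath G h lam x _ hf, lintegral_heatBath G h lam x _ hg,
    lintegral_heatBath G h lam x _ (hf.fun_mul hg), siteLaw_eq_tilted G h lam hx]
  exact freeLaw_tilted_fkg hβ lam (integrable_siteField G h hx ρ) (hf.comp (measurable_update ρ))
    (hg.comp (measurable_update ρ)) (pathMono_update hfm x ρ) (pathMono_update hgm x ρ)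

/-! ### Reversibility -/

/-- Resampling one coordinate of a product measure from its own marginal preserves the measure;
boxes suffice to see it. -/
lemma lintegral_pi_update {m : Measure (SpinPath β)} [IsProbabilityMeasure m] (x : V)
    {F : Config V β → ℝ≥0∞} (hF : Measurable F) :
    ∫⁻ σ, F σ ∂(Measure.pi fun _ : V => m)
      = ∫⁻ ρ, ∫⁻ s, F (Function.update ρ x s) ∂m ∂(Measure.pi fun _ : V => m) := by
  have hU : Measurable fun p : Config V β × SpinPath β => Function.update p.1 x p.2 :=
    measurable_update'
  have hmap : ((Measure.pi fun _ : V => m).prod m).map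
      (fun p : Config V β × SpinPath β => Function.update p.1 x p.2) = Measure.pi fun _ : V => m := by
    symm
    refine Measure.pi_eq fun S hS => ?_
    rw [Measure.map_apply hU (MeasurableSet.univ_pi hS)]
    have : (fun p : Config V β × SpinPath β => Function.update p.1 x p.2) ⁻¹' univ.pi S
        = (univ.pi (Function.update S x univ)) ×ˢ S x := by
      ext p
      simp only [mem_preimage, Set.mem_pi, mem_univ, true_imp_iff, mem_prod]
      constructor
      · intro hp
        refine ⟨fun y => ?_, by simpa using hp x⟩
        by_cases hy : y = x
        · subst hy; simp
        · simpa [Function.update_of_ne hy] using hp y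
      · rintro ⟨hp, hx⟩ y
        by_cases hy : y = x
        · subst hy; simpa using hx
        · simpa [Function.update_of_ne hy] using hp y
    rw [this, Measure.prod_prod, Measure.pi_pi, ← Finset.mul_prod_erase _ _ (Finset.mem_univ x),
      ← Finset.mul_prod_erase _ (fun i => m (S i)) (Finset.mem_univ x), Function.update_self,
      measure_univ, one_mul, mul_comm]
    congr 1
    refine Finset.prod_congr rfl fun y hy => ?_
    rw [Function.update_of_ne (Finset.ne_of_mem_erase hy)]
  conv_lhs => rw [← hmap]
  rw [lintegral_map hF hU, lintegral_prod (fun p : Config V β × SpinPath β => F (Function.update p.1 x p.2))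
    (hF.comp hU).aemeasurable]

/-- The part of the energy which does not depend on the spin at `x`. -/
def offEnergy (x : V) (ρ : Config V β) : ℝ :=
  ∑ e ∈ G.edgeFinset \ G.incidenceFinset x,
      Sym2.lift ⟨fun i j => dot (ρ i).1 (ρ j).1, fun i j => by simp only [dot, mul_comm]⟩ e
    + ∑ i ∈ Finset.univ.erase x, dot (h i) (ρ i).1

lemma offEnergy_update (x : V) (ρ : Config V β) (s : SpinPath β) :
    offEnergy G h x (Function.update ρ x s) = offEnergy G h x ρ := by
  refine congrArg₂ (· + ·) (Finset.sum_congr rfl fun e he => ?_) (Finset.sum_congr rfl fun y hy => ?_)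
  · induction e using Sym2.ind with
    | _ i j =>
      simp only [Finset.mem_sdiff, SimpleGraph.mem_edgeFinset, SimpleGraph.mem_incidenceFinset,
        SimpleGraph.incidenceSet, mem_ofPred_eq, not_and, SimpleGraph.mem_edgeSet] at he
      have h2 := he.2 he.1
      rw [Sym2.mem_iff, not_or] at h2
      simp only [Sym2.lift_mk, Function.update_of_ne (Ne.symm h2.1),
        Function.update_of_ne (Ne.symm h2.2)]
  · rw [Function.update_of_ne (Finset.ne_of_mem_erase hy)]

lemma energy_eq_offEnergy_add (x : V) (ρ : Config V β) :
    energy G β h ρ = offEnergy G h x ρ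
      + (dot (h x) (ρ x).1 + ∑ y ∈ G.neighborFinset x, dot (ρ y).1 (ρ x).1) := by
  have hinc : G.incidenceFinset x ⊆ G.edgeFinset := by
    intro e he
    rw [SimpleGraph.mem_incidenceFinset] at he
    exact SimpleGraph.mem_edgeFinset.2 he.1
  -- The edges at `x` are indexed by the neighbours of `x`, so their part of the energy becomes the
  -- interaction term of the site law.
  have himg : G.incidenceFinset x = (G.neighborFinset x).image fun y => s(y, x) := by
    ext e
    induction e using Sym2.ind with
    | _ i j =>
      simp only [SimpleGraph.mem_incidenceFinset, SimpleGraph.incidenceSet, mem_ofPred_eq,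
        SimpleGraph.mem_edgeSet, Sym2.mem_iff, Finset.mem_image, SimpleGraph.mem_neighborFinset,
        Sym2.eq_iff]
      constructor
      · rintro ⟨hij, rfl | rfl⟩
        · exact ⟨j, hij, Or.inr ⟨rfl, rfl⟩⟩
        · exact ⟨i, hij.symm, Or.inl ⟨rfl, rfl⟩⟩
      · rintro ⟨y, hy, ⟨rfl, rfl⟩ | ⟨rfl, rfl⟩⟩
        · exact ⟨hy.symm, Or.inr rfl⟩
        · exact ⟨hy, Or.inl rfl⟩
  rw [energy, offEnergy, ← Finset.sum_sdiff hinc,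
    ← Finset.sum_erase_add _ _ (Finset.mem_univ x), himg, Finset.sum_image]
  · simp only [Sym2.lift_mk]
    ring
  · intro y _ z _ hyz
    rcases Sym2.eq_iff.1 hyz with ⟨h1, -⟩ | ⟨h1, h2⟩
    · exact h1
    · exact h1.trans h2

lemma measurable_energy : Measurable (energy G β h) := by
  refine (Finset.measurable_sum _ fun e _ => ?_).add (Finset.measurable_sum _ fun i _ =>
    (measurable_dot_field (h i)).comp (measurable_pi_apply i))
  induction e using Sym2.ind with
  | _ i j =>
    simp only [Sym2.lift_mk]
    exact (measurable_dot_spins β).comp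
      (f := fun σ : Config V β => (σ i, σ j)) ((measurable_pi_apply i).prodMk (measurable_pi_apply j))

lemma exists_abs_energy_le : ∃ C, ∀ σ, |energy G β h σ| ≤ C := by
  refine ⟨∑ _e ∈ G.edgeFinset, ∫ t, |(1 : ℝ)| ∂(timeMeasure β)
    + ∑ i, ∫ t, |h i t| ∂(timeMeasure β), fun σ => ?_⟩
  refine (abs_add_le _ _).trans (add_le_add ?_ ?_)
  · refine (Finset.abs_sum_le_sum_abs _ _).trans (Finset.sum_le_sum fun e _ => ?_)
    induction e using Sym2.ind with
    | _ i j =>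
      simp only [Sym2.lift_mk]
      simpa [abs_path] using abs_dot_le (σ i).1 (σ j)
  · exact (Finset.abs_sum_le_sum_abs _ _).trans (Finset.sum_le_sum fun i _ => abs_dot_le _ _)

lemma isProbabilityMeasure_gibbs (hβ : 0 < β) : IsProbabilityMeasure (gibbs G β h lam) := by
  have := isProbabilityMeasure_freeLaw hβ lam
  obtain ⟨C, hC⟩ := exists_abs_energy_le G h
  refine isProbabilityMeasure_tilted (Integrable.of_bound
    (Real.measurable_exp.comp (measurable_energy G h)).aestronglyMeasurable (Real.exp C)
    (Eventually.of_forall fun σ => ?_))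
  rw [Real.norm_eq_abs, Real.abs_exp]
  exact Real.exp_le_exp.2 ((le_abs_self _).trans (hC σ))

lemma measurable_lintegral_kernel {α : Type*} [MeasurableSpace α] (κ : Kernel α α)
    {F : α → ℝ≥0∞} (hF : Measurable F) : Measurable fun ρ => ∫⁻ σ, F σ ∂(κ ρ) :=
  hF.lintegral_kernel

/-- The Gibbs measure is invariant under the heat bath updates. -/
lemma lintegral_gibbs_heatBath (hβ : 0 < β) {x : V} (hx : Integrable (h x) (timeMeasure β))
    {F : Config V β → ℝ≥0∞} (hF : Measurable F) :
    ∫⁻ ρ, ∫⁻ σ, F σ ∂(heatBath G β h lam x ρ) ∂(gibbs G β h lam) = ∫⁻ σ, F σ ∂(gibbs G β h lam) := by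
  have := isProbabilityMeasure_freeLaw hβ lam
  have hK := measurable_lintegral_kernel (heatBath G β h lam x) hF
  rw [gibbs, lintegral_tilted, lintegral_tilted]
  generalize ∫ σ, Real.exp (energy G β h σ) ∂(Measure.pi fun _ : V => freeLaw β lam) = Z
  have hWm : Measurable fun σ => ENNReal.ofReal (Real.exp (energy G β h σ) / Z) :=
    ((Real.measurable_exp.comp (measurable_energy G h)).div_const _).ennreal_ofReal
  -- As a function of the spin `s` at `x`, the Gibbs weight is a constant times the weight of `s` in
  -- the site field.
  have hW : ∀ ρ s, ENNReal.ofReal (Real.exp (energy G β h (Function.update ρ x s)) / Z)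
      = ENNReal.ofReal (Real.exp (offEnergy G h x ρ) / Z) * fieldWeight (siteField G h x ρ) s := by
    intro ρ s
    have hs : ∀ y ∈ G.neighborFinset x, dot (Function.update ρ x s y).1 s.1 = dot (ρ y).1 s.1 :=
      fun y hy => by
        have : y ≠ x := fun hyx => G.loopless.irrefl x (by simp [hyx] at hy)
        rw [Function.update_of_ne this]
    rw [coe_fieldWeight, ← ENNReal.ofReal_mul' (Real.exp_pos _).le, div_mul_eq_mul_div,
      ← Real.exp_add, energy_eq_offEnergy_add G h x, offEnergy_update, dot_siteField G h hx,
      Function.update_self, Finset.sum_congr rfl hs]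
  -- Both sides now integrate the spin at `x` first under the free law. With the other spins fixed,
  -- the site partition function produced by the Gibbs weight cancels the normalization of the site
  -- law.
  rw [lintegral_pi_update x (hWm.fun_mul hK), lintegral_pi_update x (hWm.fun_mul hF)]
  refine lintegral_congr fun ρ => ?_
  have hFu : Measurable fun s => F (Function.update ρ x s) := hF.comp (measurable_update ρ)
  have hw := (measurable_fieldWeight (siteField G h x ρ)).coe_nnreal_ennreal
  simp only [hW, lintegral_heatBath_update G h lam hx ρ _ hF,
    lintegral_heatBath G h lam x ρ hF]
  rw [siteLaw_eq_tilted G h lam hx, lintegral_tilted_dot _ _ hFu, lintegral_mul_const _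
    (hw.const_mul _), lintegral_const_mul _ hw]
  simp_rw [mul_assoc]
  rw [lintegral_const_mul _ (hw.fun_mul hFu)]
  congr 1
  rw [← mul_assoc, ENNReal.mul_inv_cancel (lintegral_fieldWeight_ne_zero _ _)
    (lintegral_fieldWeight_ne_top _ _), one_mul]

/-- By invariance the integrand may be averaged with `μ_x` first; `μ_x(g)` does not see the spin at
`x` and comes out. The right side is symmetric in `f` and `g`, which gives reversibility. -/
lemma lintegral_mul_heatBath (hβ : 0 < β) {x : V} (hx : Integrable (h x) (timeMeasure β))
    {f g : Config V β → ℝ≥0∞} (hf : Measurable f) (hg : Measurable g) :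
    ∫⁻ ρ, f ρ * ∫⁻ σ, g σ ∂(heatBath G β h lam x ρ) ∂(gibbs G β h lam)
      = ∫⁻ ρ, (∫⁻ σ, f σ ∂(heatBath G β h lam x ρ)) * ∫⁻ σ, g σ ∂(heatBath G β h lam x ρ)
          ∂(gibbs G β h lam) := by
  have hK := measurable_lintegral_kernel (heatBath G β h lam x) hg
  rw [← lintegral_gibbs_heatBath G h lam hβ hx (hf.fun_mul hK)]
  refine lintegral_congr fun ρ => ?_
  rw [lintegral_heatBath G h lam x ρ (hf.fun_mul hK), lintegral_heatBath G h lam x ρ hf]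
  simp only [lintegral_heatBath_update G h lam hx ρ _ hg]
  exact lintegral_mul_const _ (hf.comp (measurable_update ρ))

end Sites

/-! ### Exponential series in `[0, ∞]` -/

lemma tsum_sum_antidiagonal (F : ℕ → ℕ → ℝ≥0∞) :
    ∑' n, ∑ p ∈ Finset.HasAntidiagonal.antidiagonal n, F p.1 p.2 = ∑' i, ∑' j, F i j := by
  rw [← ENNReal.tsum_prod, ← Finset.HasAntidiagonal.sigmaAntidiagonalEquivProd.tsum_eq
    (fun p : ℕ × ℕ => F p.1 p.2), ENNReal.tsum_sigma']
  refine tsum_congr fun n => ?_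
  rw [tsum_fintype, ← Finset.sum_coe_sort]
  rfl

lemma poissonWeight_mul_choose (s t : ℝ≥0) {n : ℕ} {p : ℕ × ℕ} (hp : p ∈ Finset.HasAntidiagonal.antidiagonal n) :
    poissonWeight s p.1 * poissonWeight t p.2
      = (n.choose p.1 : ℝ≥0) * (s ^ p.1 * t ^ p.2) / n.factorial := by
  rw [Finset.HasAntidiagonal.mem_antidiagonal] at hp
  subst hp
  have h := Nat.choose_mul_factorial_mul_factorial (Nat.le_add_right p.1 p.2)
  rw [Nat.add_sub_cancel_left] at h
  have h' : ((p.1 + p.2).choose p.1 : ℝ≥0) * p.1.factorial * p.2.factorial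
      = (p.1 + p.2).factorial := by exact_mod_cast h
  have h1 : (p.1.factorial : ℝ≥0) ≠ 0 := by positivity
  have h2 : (p.2.factorial : ℝ≥0) ≠ 0 := by positivity
  have h3 : ((p.1 + p.2).factorial : ℝ≥0) ≠ 0 := by positivity
  rw [poissonWeight, poissonWeight, div_mul_div_comm, div_eq_div_iff (mul_ne_zero h1 h2) h3, ← h']
  ring

lemma sum_antidiagonal_poissonWeight (s t : ℝ≥0) (n : ℕ) :
    ∑ p ∈ Finset.HasAntidiagonal.antidiagonal n, poissonWeight s p.1 * poissonWeight t p.2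
      = poissonWeight (s + t) n := by
  rw [Finset.sum_congr rfl fun p hp => poissonWeight_mul_choose s t hp, ← Finset.sum_div,
    poissonWeight, (Commute.all s t).add_pow']
  simp only [nsmul_eq_mul]

lemma tsum_poissonWeight (t : ℝ≥0) :
    ∑' n, (poissonWeight t n : ℝ≥0∞) = ENNReal.ofReal (Real.exp t) := by
  have h : ∀ n, (poissonWeight t n : ℝ≥0∞) = ENNReal.ofReal ((t : ℝ) ^ n / n.factorial) := fun n => by
    rw [← ENNReal.ofReal_coe_nnreal]; simp [poissonWeight]
  simp_rw [h]
  rw [← ENNReal.ofReal_tsum_of_nonneg (fun n => by positivity) (Real.summable_pow_div_factorial _),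
    Real.exp_eq_exp_ℝ, NormedSpace.exp_eq_tsum_div]

/-! ### Action of kernels on functions -/

section Action

variable {α : Type*} [MeasurableSpace α]

/-- The action of a kernel on functions. -/
def act (κ : Kernel α α) (f : α → ℝ≥0∞) (ρ : α) : ℝ≥0∞ := ∫⁻ σ, f σ ∂(κ ρ)

lemma measurable_act (κ : Kernel α α) {f : α → ℝ≥0∞} (hf : Measurable f) : Measurable (act κ f) :=
  measurable_lintegral_kernel κ hf

/-- On functions the order is reversed: `κ ∘ₖ η` moves by `η` first, so the innermost operator is
`κ`. -/
lemma act_comp (κ η : Kernel α α) {f : α → ℝ≥0∞} (hf : Measurable f) :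
    act (κ ∘ₖ η) f = act η (act κ f) :=
  funext fun ρ => Kernel.lintegral_comp κ η ρ hf

lemma act_pow_zero (κ : Kernel α α) {f : α → ℝ≥0∞} (hf : Measurable f) : act (κ ^ 0) f = f :=
  funext fun ρ => by
    change ∫⁻ σ, f σ ∂((Kernel.id : Kernel α α) ρ) = f ρ
    exact Kernel.lintegral_id' hf ρ

lemma act_pow_succ (κ : Kernel α α) (n : ℕ) {f : α → ℝ≥0∞} (hf : Measurable f) :
    act (κ ^ (n + 1)) f = act κ (act (κ ^ n) f) := by
  rw [Kernel.pow_add, pow_one, act_comp _ _ hf]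

lemma act_pow_add (κ : Kernel α α) (m n : ℕ) {f : α → ℝ≥0∞} (hf : Measurable f) :
    act (κ ^ (m + n)) f = act (κ ^ m) (act (κ ^ n) f) := by
  rw [add_comm, Kernel.pow_add, act_comp _ _ hf]

/-- A kernel which acts as a symmetric operator with respect to `μ`. -/
def IsSymmetricKernel (κ : Kernel α α) (μ : Measure α) : Prop :=
  ∀ f g, Measurable f → Measurable g → ∫⁻ ρ, f ρ * act κ g ρ ∂μ = ∫⁻ ρ, act κ f ρ * g ρ ∂μ

lemma IsSymmetricKernel.pow {κ : Kernel α α} {μ : Measure α} (hκ : IsSymmetricKernel κ μ) (n : ℕ) :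
    IsSymmetricKernel (κ ^ n) μ := by
  intro f g hf hg
  induction n generalizing f g with
  | zero => rw [act_pow_zero κ hf, act_pow_zero κ hg]
  | succ n ih =>
    rw [act_pow_succ κ n hg, hκ _ _ hf (measurable_act _ hg), ih _ _ (measurable_act κ hf) hg,
      act_pow_add κ n 1 hf, pow_one]

/-- Symmetry tested against indicators: a law with density `f` is transported to the law with
density `act κ f`. -/
lemma IsSymmetricKernel.bind_withDensity {κ : Kernel α α} {μ : Measure α}
    (hκ : IsSymmetricKernel κ μ) {f : α → ℝ≥0∞} (hf : Measurable f) :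
    (μ.withDensity f).bind κ = μ.withDensity (act κ f) := by
  ext S hS
  have h1 : Measurable (S.indicator fun _ => (1 : ℝ≥0∞)) := measurable_const.indicator hS
  have h2 : act κ (S.indicator fun _ => 1) = fun ρ => κ ρ S := by
    funext ρ; simp [act, lintegral_indicator hS]
  have h3 := hκ f _ hf h1
  rw [h2] at h3
  rw [Measure.bind_apply hS κ.aemeasurable, withDensity_apply _ hS,
    lintegral_withDensity_eq_lintegral_mul _ hf (κ.measurable_coe hS), ← lintegral_indicator hS]
  refine h3.trans (lintegral_congr fun ρ => ?_)
  by_cases hρ : ρ ∈ S <;> simp [hρ]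

end Action

/-! ### The flow of the heat bath dynamics -/

section Flow

variable {V : Type*} [Fintype V] [DecidableEq V] (G : SimpleGraph V) [DecidableRel G.Adj]
  {β : ℝ} (h : V → Icc (0 : ℝ) β → ℝ) (lam : ℝ≥0)

/-- The kernel `∑_{x ∈ A} μ_x`. -/
abbrev updateSum (A : Finset V) : Kernel (Config V β) (Config V β) :=
  ∑ x ∈ A, heatBath G β h lam x

lemma act_updateSum (A : Finset V) (f : Config V β → ℝ≥0∞) (ρ : Config V β) :
    act (updateSum G h lam A) f ρ = ∑ x ∈ A, act (heatBath G β h lam x) f ρ := by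
  rw [act, updateSum, sum_apply, lintegral_finsetSum_measure]
  rfl

lemma isSymmetricKernel_heatBath (hβ : 0 < β) (hh : ∀ x, Integrable (h x) (timeMeasure β)) (x : V) :
    IsSymmetricKernel (heatBath G β h lam x) (gibbs G β h lam) := by
  intro f g hf hg
  have h1 := lintegral_mul_heatBath G h lam hβ (hh x) hf hg
  have h2 := lintegral_mul_heatBath G h lam hβ (hh x) hg hf
  simp only [act]
  rw [h1]
  simp_rw [mul_comm _ (g _)]
  rw [h2]
  simp_rw [mul_comm]

lemma isSymmetricKernel_updateSum (hβ : 0 < β) (hh : ∀ x, Integrable (h x) (timeMeasure β))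
    (A : Finset V) : IsSymmetricKernel (updateSum G h lam A) (gibbs G β h lam) := by
  intro f g hf hg
  simp_rw [act_updateSum, Finset.mul_sum, Finset.sum_mul]
  rw [lintegral_finsetSum _ fun x _ => hf.fun_mul (measurable_act _ hg),
    lintegral_finsetSum _ fun x _ => (measurable_act _ hf).fun_mul hg]
  exact Finset.sum_congr rfl fun x _ => isSymmetricKernel_heatBath G h lam hβ hh x f g hf hg

lemma configMono_act_updateSum (hβ : 0 < β) (hh : ∀ x, Integrable (h x) (timeMeasure β))
    (A : Finset V) {f : Config V β → ℝ≥0∞} (hf : Measurable f) (hfm : ConfigMono f) :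
    ConfigMono (act (updateSum G h lam A) f) := by
  intro σ τ hστ
  rw [act_updateSum, act_updateSum]
  exact Finset.sum_le_sum fun x _ => configMono_heatBath G h lam hβ (hh x) hf hfm σ τ hστ

lemma configMono_act_pow (hβ : 0 < β) (hh : ∀ x, Integrable (h x) (timeMeasure β))
    (A : Finset V) (n : ℕ) {f : Config V β → ℝ≥0∞} (hf : Measurable f) (hfm : ConfigMono f) :
    ConfigMono (act (updateSum G h lam A ^ n) f) := by
  induction n with
  | zero => rwa [act_pow_zero _ hf]
  | succ n ih =>
    rw [act_pow_succ _ _ hf]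
    exact configMono_act_updateSum G h lam hβ hh A (measurable_act _ hf) ih

/-- Updating a spin decreases the correlation of two increasing functions. -/
lemma lintegral_mul_act_heatBath_le (hβ : 0 < β) (hh : ∀ x, Integrable (h x) (timeMeasure β))
    (x : V) {f g : Config V β → ℝ≥0∞} (hf : Measurable f) (hg : Measurable g)
    (hfm : ConfigMono f) (hgm : ConfigMono g) :
    ∫⁻ ρ, f ρ * act (heatBath G β h lam x) g ρ ∂(gibbs G β h lam)
      ≤ ∫⁻ ρ, f ρ * g ρ ∂(gibbs G β h lam) := by
  simp only [act]
  -- The left side becomes `∫ μ_x(f) μ_x(g)` and the right side `∫ μ_x(f g)`; positive association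
  -- compares the integrands.
  rw [lintegral_mul_heatBath G h lam hβ (hh x) hf hg,
    ← lintegral_gibbs_heatBath G h lam hβ (hh x) (hf.fun_mul hg)]
  exact lintegral_mono fun ρ => lintegral_heatBath_mul_le G h lam hβ (hh x) hf hg hfm hgm ρ

/-- Each update in `B \ A` is replaced by the identity, which can only increase the correlation. -/
lemma lintegral_mul_act_updateSum_le (hβ : 0 < β) (hh : ∀ x, Integrable (h x) (timeMeasure β))
    {A B : Finset V} (hAB : A ⊆ B) {f g : Config V β → ℝ≥0∞} (hf : Measurable f)
    (hg : Measurable g) (hfm : ConfigMono f) (hgm : ConfigMono g) :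
    ∫⁻ ρ, f ρ * act (updateSum G h lam B) g ρ ∂(gibbs G β h lam)
      ≤ ((B \ A).card : ℝ≥0∞) * ∫⁻ ρ, f ρ * g ρ ∂(gibbs G β h lam)
        + ∫⁻ ρ, f ρ * act (updateSum G h lam A) g ρ ∂(gibbs G β h lam) := by
  simp_rw [act_updateSum, Finset.mul_sum]
  rw [lintegral_finsetSum _ fun x _ => hf.fun_mul (measurable_act _ hg),
    lintegral_finsetSum _ fun x _ => hf.fun_mul (measurable_act _ hg), ← Finset.sum_sdiff hAB]
  refine add_le_add ?_ le_rfl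
  rw [← nsmul_eq_mul]
  exact Finset.sum_le_card_nsmul _ _ _ fun x _ =>
    lintegral_mul_act_heatBath_le G h lam hβ hh x hf hg hfm hgm

/-- The right side is the binomial expansion of `(U_A + m) ^ n`, where `U_A` is the sum of the
updates in `A` and `m` the number of sites of `B \ A`. In the induction, symmetry moves `U_A` onto
`f`, which stays increasing; so `U_A` and `U_B` need not commute. -/
lemma lintegral_mul_act_pow_le (hβ : 0 < β) (hh : ∀ x, Integrable (h x) (timeMeasure β))
    {A B : Finset V} (hAB : A ⊆ B) (n : ℕ) {f g : Config V β → ℝ≥0∞} (hf : Measurable f)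
    (hg : Measurable g) (hfm : ConfigMono f) (hgm : ConfigMono g) :
    ∫⁻ ρ, f ρ * act (updateSum G h lam B ^ n) g ρ ∂(gibbs G β h lam)
      ≤ ∑ p ∈ Finset.HasAntidiagonal.antidiagonal n, (n.choose p.1 : ℝ≥0∞) * (((B \ A).card : ℝ≥0∞) ^ p.2 *
        ∫⁻ ρ, f ρ * act (updateSum G h lam A ^ p.1) g ρ ∂(gibbs G β h lam)) := by
  induction n generalizing f with
  | zero => simp
  | succ n ih =>
    have hBm := configMono_act_pow G h lam hβ hh B n hg hgm
    rw [act_pow_succ _ _ hg]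
    refine (lintegral_mul_act_updateSum_le G h lam hβ hh hAB hf (measurable_act _ hg)
      hfm hBm).trans ?_
    rw [isSymmetricKernel_updateSum G h lam hβ hh A _ _ hf (measurable_act _ hg)]
    have h1 := ih hf hfm
    have h2 := ih (measurable_act _ hf) (configMono_act_updateSum G h lam hβ hh A hf hfm)
    rw [Finset.sum_antidiagonal_choose_succ_mul fun i j => ((B \ A).card : ℝ≥0∞) ^ j *
        ∫⁻ ρ, f ρ * act (updateSum G h lam A ^ i) g ρ ∂(gibbs G β h lam)]
    refine add_le_add ((mul_le_mul_right h1 _).trans_eq ?_) (h2.trans_eq ?_)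
    · rw [Finset.mul_sum]
      refine Finset.sum_congr rfl fun p _ => ?_
      rw [pow_succ]
      ring
    · refine Finset.sum_congr rfl fun p hp => ?_
      rw [Finset.HasAntidiagonal.mem_antidiagonal] at hp
      rw [act_pow_succ _ _ hg,
        isSymmetricKernel_updateSum G h lam hβ hh A _ _ hf (measurable_act _ hg),
        ← Nat.choose_symm_of_eq_add hp.symm]

lemma act_heatFlow (A : Finset V) (t : ℝ≥0) (f : Config V β → ℝ≥0∞) (ρ : Config V β) :
    act (heatFlow G β h lam A t) f ρ = ENNReal.ofReal (Real.exp (-(t * A.card))) *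
      ∑' n, (poissonWeight t n : ℝ≥0∞) * act (updateSum G h lam A ^ n) f ρ := by
  rw [← ENNReal.tsum_mul_left]
  refine (lintegral_sum_measure _ _).trans (tsum_congr fun n => ?_)
  rw [lintegral_smul_measure, smul_eq_mul, mul_div_assoc, ENNReal.ofReal_mul (Real.exp_pos _).le,
    mul_assoc]
  congr 2
  rw [← ENNReal.ofReal_coe_nnreal]
  simp [poissonWeight]

lemma lintegral_mul_act_heatFlow (A : Finset V) (t : ℝ≥0) {f g : Config V β → ℝ≥0∞}
    (hf : Measurable f) (hg : Measurable g) :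
    ∫⁻ ρ, f ρ * act (heatFlow G β h lam A t) g ρ ∂(gibbs G β h lam)
      = ENNReal.ofReal (Real.exp (-(t * A.card))) * ∑' n, (poissonWeight t n : ℝ≥0∞) *
        ∫⁻ ρ, f ρ * act (updateSum G h lam A ^ n) g ρ ∂(gibbs G β h lam) := by
  have hm : ∀ n, Measurable fun ρ => f ρ * act (updateSum G h lam A ^ n) g ρ := fun n =>
    hf.fun_mul (measurable_act _ hg)
  have h1 : ∀ ρ, f ρ * act (heatFlow G β h lam A t) g ρ
      = ENNReal.ofReal (Real.exp (-(t * A.card))) * ∑' n, (poissonWeight t n : ℝ≥0∞) *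
        (f ρ * act (updateSum G h lam A ^ n) g ρ) := fun ρ => by
    rw [act_heatFlow, mul_left_comm, ← ENNReal.tsum_mul_left]
    simp_rw [mul_left_comm (f ρ)]
  simp_rw [h1]
  rw [lintegral_const_mul _ (Measurable.tsum fun n => (hm n).const_mul _),
    lintegral_tsum fun n => ((hm n).const_mul _).aemeasurable]
  simp_rw [lintegral_const_mul _ (hm _)]

lemma isSymmetricKernel_heatFlow (hβ : 0 < β) (hh : ∀ x, Integrable (h x) (timeMeasure β))
    (A : Finset V) (t : ℝ≥0) :
    IsSymmetricKernel (heatFlow G β h lam A t) (gibbs G β h lam) := by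
  intro f g hf hg
  have h1 : ∀ ρ, act (heatFlow G β h lam A t) f ρ * g ρ
      = g ρ * act (heatFlow G β h lam A t) f ρ := fun ρ => mul_comm _ _
  simp_rw [h1]
  rw [lintegral_mul_act_heatFlow G h lam A t hf hg, lintegral_mul_act_heatFlow G h lam A t hg hf]
  congr 1
  refine tsum_congr fun n => ?_
  rw [(isSymmetricKernel_updateSum G h lam hβ hh A).pow n _ _ hf hg]
  simp_rw [mul_comm (g _)]

lemma configMono_act_heatFlow (hβ : 0 < β) (hh : ∀ x, Integrable (h x) (timeMeasure β))
    (A : Finset V) (t : ℝ≥0) {f : Config V β → ℝ≥0∞} (hf : Measurable f) (hfm : ConfigMono f) :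
    ConfigMono (act (heatFlow G β h lam A t) f) := by
  intro σ τ hστ
  rw [act_heatFlow, act_heatFlow]
  gcongr with n
  exact configMono_act_pow G h lam hβ hh A n hf hfm σ τ hστ

/-- **Censoring on a time interval**: fewer updates give a larger correlation of two increasing
functions. -/
theorem lintegral_mul_act_heatFlow_le (hβ : 0 < β) (hh : ∀ x, Integrable (h x) (timeMeasure β))
    {A B : Finset V} (hAB : A ⊆ B) (t : ℝ≥0) {f g : Config V β → ℝ≥0∞} (hf : Measurable f)
    (hg : Measurable g) (hfm : ConfigMono f) (hgm : ConfigMono g) :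
    ∫⁻ ρ, f ρ * act (heatFlow G β h lam B t) g ρ ∂(gibbs G β h lam)
      ≤ ∫⁻ ρ, f ρ * act (heatFlow G β h lam A t) g ρ ∂(gibbs G β h lam) := by
  rw [lintegral_mul_act_heatFlow G h lam B t hf hg, lintegral_mul_act_heatFlow G h lam A t hf hg]
  set m := (B \ A).card with hm
  set a : ℕ → ℝ≥0∞ := fun i =>
    ∫⁻ ρ, f ρ * act (updateSum G h lam A ^ i) g ρ ∂(gibbs G β h lam) with ha
  have hcard : B.card = A.card + m := by
    rw [hm, add_comm, Finset.card_sdiff_add_card_eq_card hAB]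
  have h1 : ∀ n, (poissonWeight t n : ℝ≥0∞) *
      ∫⁻ ρ, f ρ * act (updateSum G h lam B ^ n) g ρ ∂(gibbs G β h lam)
      ≤ ∑ p ∈ Finset.HasAntidiagonal.antidiagonal n,
        (poissonWeight t p.1 : ℝ≥0∞) * a p.1 * (poissonWeight (t * m) p.2 : ℝ≥0∞) := fun n => by
    refine (mul_le_mul_right (lintegral_mul_act_pow_le G h lam hβ hh hAB n hf hg hfm hgm) _).trans_eq ?_
    rw [Finset.mul_sum]
    refine Finset.sum_congr rfl fun p hp => ?_
    have h2 := poissonWeight_mul_choose t (t * m) hp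
    have h3 : poissonWeight t n * ((n.choose p.1 : ℝ≥0) * (m : ℝ≥0) ^ p.2)
        = poissonWeight t p.1 * poissonWeight (t * m) p.2 := by
      rw [h2, poissonWeight, ← Finset.HasAntidiagonal.mem_antidiagonal.1 hp, pow_add, mul_pow]
      ring
    have h4 := congrArg ((↑) : ℝ≥0 → ℝ≥0∞) h3
    push_cast at h4
    calc _ = (poissonWeight t n : ℝ≥0∞) * ((n.choose p.1 : ℝ≥0∞) * (m : ℝ≥0∞) ^ p.2) * a p.1 := by
          simp only [ha]; ring
      _ = _ := by rw [h4]; ring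
  -- The double series is a Cauchy product; its factor `exp (t * m)` turns `exp (-t |B|)` into `exp
  -- (-t |A|)`.
  calc _ ≤ ENNReal.ofReal (Real.exp (-(t * B.card))) * ∑' n, ∑ p ∈ Finset.HasAntidiagonal.antidiagonal n,
        (poissonWeight t p.1 : ℝ≥0∞) * a p.1 * (poissonWeight (t * m) p.2 : ℝ≥0∞) := by
        gcongr with n
        exact h1 n
    _ = ENNReal.ofReal (Real.exp (-(t * B.card))) * ENNReal.ofReal (Real.exp (t * m : ℝ≥0)) *
        ∑' i, (poissonWeight t i : ℝ≥0∞) * a i := by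
        rw [tsum_sum_antidiagonal fun i j =>
          (poissonWeight t i : ℝ≥0∞) * a i * (poissonWeight (t * m) j : ℝ≥0∞)]
        simp_rw [ENNReal.tsum_mul_left, tsum_poissonWeight, ENNReal.tsum_mul_right]
        ring
    _ = _ := by
        rw [← ENNReal.ofReal_mul (Real.exp_pos _).le, ← Real.exp_add, hcard]
        congr 3
        push_cast
        ring

/-- The semigroup law, by the Cauchy product of exponential series. It allows an interval of one
schedule to be cut at a discontinuity of the other. -/
lemma heatFlow_comp (A : Finset V) (s t : ℝ≥0) :
    heatFlow G β h lam A s ∘ₖ heatFlow G β h lam A t = heatFlow G β h lam A (s + t) := by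
  ext ρ S hS
  set f : Config V β → ℝ≥0∞ := S.indicator fun _ => 1 with hfdef
  have hf : Measurable f := measurable_const.indicator hS
  have happ : ∀ κ : Kernel (Config V β) (Config V β), κ ρ S = act κ f ρ := fun κ => by
    simp [act, hfdef, lintegral_indicator hS]
  rw [happ, happ, act_comp _ _ hf, act_heatFlow, act_heatFlow]
  have h1 : ∀ n, act (updateSum G h lam A ^ n) (act (heatFlow G β h lam A s) f) ρ
      = ENNReal.ofReal (Real.exp (-(s * A.card))) *
        ∑' i, (poissonWeight s i : ℝ≥0∞) * act (updateSum G h lam A ^ (n + i)) f ρ := fun n => by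
    have hm : ∀ i, Measurable (act (updateSum G h lam A ^ i) f) := fun i => measurable_act _ hf
    conv_lhs => rw [act]
    simp_rw [act_heatFlow]
    rw [lintegral_const_mul _ (Measurable.tsum fun i => (hm i).const_mul _),
      lintegral_tsum fun i => ((hm i).const_mul _).aemeasurable]
    simp_rw [lintegral_const_mul _ (hm _), act_pow_add _ _ _ hf]
    rfl
  simp_rw [h1]
  have h2 : ∀ n, (poissonWeight (s + t) n : ℝ≥0∞) * act (updateSum G h lam A ^ n) f ρ
      = ∑ p ∈ Finset.HasAntidiagonal.antidiagonal n, (poissonWeight t p.1 : ℝ≥0∞) * ((poissonWeight s p.2 : ℝ≥0∞) *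
        act (updateSum G h lam A ^ (p.1 + p.2)) f ρ) := fun n => by
    rw [add_comm s t, ← sum_antidiagonal_poissonWeight, ENNReal.ofNNReal_finsetSum, Finset.sum_mul]
    refine Finset.sum_congr rfl fun p hp => ?_
    rw [Finset.HasAntidiagonal.mem_antidiagonal.1 hp, ENNReal.coe_mul, mul_assoc]
  simp_rw [h2]
  rw [tsum_sum_antidiagonal fun i j => (poissonWeight t i : ℝ≥0∞) * ((poissonWeight s j : ℝ≥0∞) *
        act (updateSum G h lam A ^ (i + j)) f ρ)]
  have h3 : ENNReal.ofReal (Real.exp (-((s + t : ℝ≥0) * A.card)))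
      = ENNReal.ofReal (Real.exp (-(t * A.card))) * ENNReal.ofReal (Real.exp (-(s * A.card))) := by
    rw [← ENNReal.ofReal_mul (Real.exp_pos _).le, ← Real.exp_add]
    congr 2
    push_cast
    ring
  rw [h3, mul_assoc]
  congr 1
  rw [← ENNReal.tsum_mul_left]
  refine tsum_congr fun n => ?_
  rw [ENNReal.tsum_mul_left]
  ring

lemma heatFlow_zero (A : Finset V) : heatFlow G β h lam A 0 = Kernel.id := by
  ext ρ S hS
  have h1 : Measurable (S.indicator fun _ => (1 : ℝ≥0∞)) := measurable_const.indicator hS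
  have happ : ∀ κ : Kernel (Config V β) (Config V β), κ ρ S = act κ (S.indicator fun _ => 1) ρ :=
    fun κ => by simp [act, lintegral_indicator hS]
  rw [happ, happ, act_heatFlow, tsum_eq_single 0]
  · rw [pow_zero]
    simp [poissonWeight]
    rfl
  · intro n hn
    simp [poissonWeight, hn]

/-- Every update is Markov, so the `n`-th power of the sum has total mass `|A| ^ n`, and the series
adds up to `exp (t |A|)`. -/
lemma isMarkovKernel_heatFlow (hβ : 0 < β) (hh : ∀ x, Integrable (h x) (timeMeasure β))
    (A : Finset V) (t : ℝ≥0) : IsMarkovKernel (heatFlow G β h lam A t) := by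
  have hS : ∀ n ρ, act (updateSum G h lam A ^ n) (fun _ => 1) ρ = (A.card : ℝ≥0∞) ^ n := by
    intro n
    induction n with
    | zero => intro ρ; rw [act_pow_zero _ measurable_const]; simp
    | succ n ih =>
      intro ρ
      rw [act_pow_succ _ _ measurable_const, funext ih, act_updateSum]
      have : ∀ x, act (heatBath G β h lam x) (fun _ => (A.card : ℝ≥0∞) ^ n) ρ
          = (A.card : ℝ≥0∞) ^ n := fun x => by
        have := isMarkovKernel_heatBath G h lam hβ (hh x)
        simp [act]
      simp [this, pow_succ, mul_comm]
  refine ⟨fun ρ => ⟨?_⟩⟩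
  have h1 : heatFlow G β h lam A t ρ univ = act (heatFlow G β h lam A t) (fun _ => 1) ρ := by
    simp [act]
  have h2 : ∀ n, (poissonWeight t n : ℝ≥0∞) * (A.card : ℝ≥0∞) ^ n
      = (poissonWeight (t * A.card) n : ℝ≥0∞) := fun n => by
    have : poissonWeight t n * (A.card : ℝ≥0) ^ n = poissonWeight (t * A.card) n := by
      simp only [poissonWeight, mul_pow]; ring
    rw [← this]
    push_cast
    rfl
  rw [h1, act_heatFlow]
  simp_rw [hS, h2]
  rw [tsum_poissonWeight, ← ENNReal.ofReal_mul (Real.exp_pos _).le, ← Real.exp_add]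
  simp

end Flow

/-! ### Censoring schedules -/

namespace Schedule

variable {V : Type*} [Fintype V] [DecidableEq V]

lemma rightLim_eq (A : Schedule V) {c t : ℝ≥0} (hct : c < t) {S : Finset V}
    (hS : ∀ s ∈ Ioo c t, A.toFun s = S) : A.rightLim c = S := by
  ext x
  simp only [rightLim, Finset.mem_filter, Finset.mem_univ, true_and]
  have hev : ∀ᶠ s in 𝓝[>] c, A.toFun s = S := by
    filter_upwards [Ioo_mem_nhdsGT hct] with s hs using hS s hs
  constructor
  · intro hx
    obtain ⟨s, h1, h2⟩ := (hx.and hev).exists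
    exact h2 ▸ h1
  · intro hx
    filter_upwards [hev] with s hs
    exact hs ▸ hx

lemma rightLim_mono {A B : Schedule V} (hAB : ∀ t, A.toFun t ⊆ B.toFun t) (t : ℝ≥0) :
    A.rightLim t ⊆ B.rightLim t := by
  intro x hx
  simp only [rightLim, Finset.mem_filter, Finset.mem_univ, true_and] at hx ⊢
  filter_upwards [hx] with s hs using hAB s hs

/-- Away from the listed times the schedule is locally constant, and the interval is connected. -/
lemma toFun_eq_of_mem_Ioo (A : Schedule V) {c t : ℝ≥0} (hA : ∀ i, A.time i ∉ Ioo c t)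
    {r s : ℝ≥0} (hr : r ∈ Ioo c t) (hs : s ∈ Ioo c t) : A.toFun r = A.toFun s := by
  refine isPreconnected_Ioo.induction₂ (fun r s => A.toFun r = A.toFun s) (fun r hr => ?_)
    (fun _ _ _ _ _ _ h1 h2 => h1.trans h2) (fun _ _ _ _ h1 => h1.symm) hr hs
  refine nhdsWithin_le_nhds ((A.locallyConstant r ?_).mono fun s hs => hs.symm)
  rintro ⟨i, rfl⟩
  exact hA i hr

lemma foldl_comp_id {α ι : Type*} [MeasurableSpace α] (F : ι → Kernel α α) (l : List ι)
    (hF : ∀ i ∈ l, F i = Kernel.id) (κ : Kernel α α) :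
    l.foldl (fun κ i => F i ∘ₖ κ) κ = κ := by
  induction l generalizing κ with
  | nil => rfl
  | cons i l ih =>
    rw [List.foldl_cons, hF i List.mem_cons_self, Kernel.id_comp]
    exact ih (fun j hj => hF j (List.mem_cons_of_mem i hj)) κ

variable (G : SimpleGraph V) [DecidableRel G.Adj] {β : ℝ} (h : V → Icc (0 : ℝ) β → ℝ) (lam : ℝ≥0)

lemma kernel_zero (A : Schedule V) : A.kernel G β h lam 0 = Kernel.id := by
  refine foldl_comp_id _ _ (fun i _ => ?_) _
  have : A.duration 0 i = 0 := by
    unfold duration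
    split_ifs <;> simp
  rw [this, heatFlow_zero]

/-- The dynamics on a time interval without discontinuities is a heat flow. -/
lemma kernel_eq_heatFlow_comp (A : Schedule V) {a t : ℝ≥0} (hat : a < t)
    (hA : ∀ i, A.time i ∉ Ioo a t) : A.kernel G β h lam t
      = heatFlow G β h lam (A.rightLim a) (t - a) ∘ₖ A.kernel G β h lam a := by
  -- The last index `k` with `t_k ≤ a`. Between the times `a` and `t` only factor `k` changes:
  -- earlier factors already have full duration, later ones still have duration zero.
  obtain ⟨k, hk, hkmax⟩ : ∃ k, A.time k ≤ a ∧ ∀ i, A.time i ≤ a → i ≤ k := by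
    have hne : (Finset.univ.filter fun i => A.time i ≤ a).Nonempty :=
      ⟨0, by simp [A.time_zero]⟩
    refine ⟨_, (Finset.mem_filter.1 (Finset.max'_mem _ hne)).2, fun i hi => ?_⟩
    exact Finset.le_max' _ _ (by simp [hi])
  have hgt : ∀ i, k < i → t ≤ A.time i := fun i hi => by
    have h1 : a < A.time i := not_le.1 fun h2 => (hkmax i h2).not_gt hi
    exact not_lt.1 fun h2 => hA i ⟨h1, h2⟩
  have hlt_dur : ∀ i, i < k → A.duration t i = A.duration a i := fun i hi => by
    have hi' : (i : ℕ) + 1 < A.n + 1 := lt_of_le_of_lt (Fin.lt_def.1 hi) k.2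
    have h1 : A.time ⟨i + 1, hi'⟩ ≤ a :=
      (A.time_strictMono.monotone
        (show (⟨i + 1, hi'⟩ : Fin (A.n + 1)) ≤ k from Nat.succ_le_of_lt (Fin.lt_def.1 hi))).trans hk
    simp only [duration, dif_pos hi', min_eq_right h1, min_eq_right (h1.trans hat.le)]
  have hk_dur : ∀ s, s ≤ t → A.duration s k = s - A.time k := fun s hs => by
    unfold duration
    split_ifs with hi
    · have h1 := hgt ⟨k + 1, hi⟩ (Fin.lt_def.2 (Nat.lt_succ_self _))
      rw [min_eq_left (hs.trans h1)]
    · rfl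
  have hgt_dur : ∀ s, s ≤ t → ∀ i, k < i → A.duration s i = 0 := fun s hs i hi => by
    have h1 := hs.trans (hgt i hi)
    unfold duration
    split_ifs
    · exact tsub_eq_zero_of_le ((min_le_left _ _).trans h1)
    · exact tsub_eq_zero_of_le h1
  have hright : A.rightLim a = A.rightLim (A.time k) := by
    rcases hk.eq_or_lt with h1 | h1
    · rw [h1]
    · have h2 : ∀ i, A.time i ∉ Ioo (A.time k) t := fun i hi =>
        (hgt i (A.time_strictMono.lt_iff_lt.1 hi.1)).not_gt hi.2
      rw [A.rightLim_eq hat fun s hs =>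
          A.toFun_eq_of_mem_Ioo h2 ⟨h1.trans hs.1, hs.2⟩ ⟨h1, hat⟩,
        A.rightLim_eq (h1.trans hat) fun s hs => A.toFun_eq_of_mem_Ioo h2 hs ⟨h1, hat⟩]
  obtain ⟨l₁, l₂, hl⟩ := List.append_of_mem (List.mem_finRange k)
  have hsort := List.pairwise_lt_finRange (A.n + 1)
  rw [hl, List.pairwise_append, List.pairwise_cons] at hsort
  have hl₁ : ∀ i ∈ l₁, i < k := fun i hi => hsort.2.2 i hi k List.mem_cons_self
  have hl₂ : ∀ i ∈ l₂, k < i := hsort.2.1.1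
  have hfold : ∀ s, s ≤ t → A.kernel G β h lam s
      = heatFlow G β h lam (A.rightLim a) (s - A.time k) ∘ₖ l₁.foldl
        (fun κ i => heatFlow G β h lam (A.rightLim (A.time i)) (A.duration s i) ∘ₖ κ)
        Kernel.id := fun s hs => by
    rw [kernel, hl, List.foldl_append, List.foldl_cons, foldl_comp_id _ l₂, hk_dur s hs, hright]
    intro i hi
    rw [hgt_dur s hs i (hl₂ i hi), heatFlow_zero]
  rw [hfold t le_rfl, hfold a hat.le, ← Kernel.comp_assoc, heatFlow_comp,
    tsub_add_tsub_cancel hat.le hk]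
  congr 1
  refine List.foldl_ext _ _ _ fun κ i hi => ?_
  rw [hlt_dur i (hl₁ i hi)]

end Schedule

/-! ### Comparison of two censored dynamics -/

section Comparison

variable {V : Type*} [Fintype V] [DecidableEq V] (G : SimpleGraph V) [DecidableRel G.Adj]
  {β : ℝ} (h : V → Icc (0 : ℝ) β → ℝ) (lam : ℝ≥0)

/-- `f` is a bounded increasing density of `ν` with respect to `μ`. -/
structure IsMonoDensity (ν μ : Measure (Config V β)) (f : Config V β → ℝ≥0∞) : Prop where
  measurable : Measurable f
  mono : ConfigMono f
  bounded : ∃ M : ℝ≥0, ∀ σ, f σ ≤ M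
  eq_withDensity : ν = μ.withDensity f

lemma IsMonoDensity.bind_heatFlow (hβ : 0 < β) (hh : ∀ x, Integrable (h x) (timeMeasure β))
    {ν : Measure (Config V β)} {f : Config V β → ℝ≥0∞} (hf : IsMonoDensity ν (gibbs G β h lam) f)
    (A : Finset V) (t : ℝ≥0) :
    IsMonoDensity (ν.bind (heatFlow G β h lam A t)) (gibbs G β h lam)
      (act (heatFlow G β h lam A t) f) where
  measurable := measurable_act _ hf.measurable
  mono := configMono_act_heatFlow G h lam hβ hh A t hf.measurable hf.mono
  bounded := by
    obtain ⟨M, hM⟩ := hf.bounded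
    refine ⟨M, fun σ => (lintegral_mono hM).trans ?_⟩
    have := isMarkovKernel_heatFlow G h lam hβ hh A t
    simp
  eq_withDensity := by
    rw [hf.eq_withDensity,
      (isSymmetricKernel_heatFlow G h lam hβ hh A t).bind_withDensity hf.measurable]

/-- The laws of two censored dynamics have bounded increasing densities, and the law of the
dynamics with fewer updates is the larger one. -/
theorem exists_isMonoDensity_law (hβ : 0 < β) (hh : ∀ x, Integrable (h x) (timeMeasure β))
    {A B : Schedule V} (hAB : ∀ t, A.toFun t ⊆ B.toFun t) {ν : Measure (Config V β)}
    {f : Config V β → ℝ≥0∞} (hf : IsMonoDensity ν (gibbs G β h lam) f) (t : ℝ≥0) :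
    ∃ fA fB, IsMonoDensity (A.law G β h lam ν t) (gibbs G β h lam) fA ∧
      IsMonoDensity (B.law G β h lam ν t) (gibbs G β h lam) fB ∧
      ∀ g, Measurable g → ConfigMono g →
        ∫⁻ σ, fB σ * g σ ∂(gibbs G β h lam) ≤ ∫⁻ σ, fA σ * g σ ∂(gibbs G β h lam) := by
  -- Between consecutive points of `T` both schedules are constant; the induction is on the number
  -- of points of `T` before `t`.
  let T : Finset ℝ≥0 := Finset.univ.image A.time ∪ Finset.univ.image B.time
  have hTA : ∀ i, A.time i ∈ T := fun i => by simp [T]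
  have hTB : ∀ i, B.time i ∈ T := fun i => by simp [T]
  induction hn : (T.filter (· < t)).card using Nat.strong_induction_on generalizing t with
  | _ n ih =>
    rcases eq_or_ne t 0 with rfl | ht
    · have h0 : ∀ C : Schedule V, C.law G β h lam ν 0 = ν := fun C => by
        rw [Schedule.law, Schedule.kernel_zero, Measure.id_comp]
      exact ⟨f, f, by rwa [h0], by rwa [h0], fun g _ _ => le_rfl⟩
    have hne : (T.filter (· < t)).Nonempty :=
      ⟨0, Finset.mem_filter.2 ⟨A.time_zero ▸ hTA 0, pos_iff_ne_zero.2 ht⟩⟩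
    set a := (T.filter (· < t)).max' hne with ha
    have hamem : a ∈ T.filter (· < t) := Finset.max'_mem _ hne
    have hat : a < t := (Finset.mem_filter.1 hamem).2
    have hnot : ∀ s ∈ T, s ∉ Ioo a t := fun s hs hsI =>
      (Finset.le_max' _ s (Finset.mem_filter.2 ⟨hs, hsI.2⟩)).not_gt hsI.1
    have hcard : (T.filter (· < a)).card < n := by
      rw [← hn]
      refine Finset.card_lt_card ⟨fun s hs => ?_, fun hsub => ?_⟩
      · rw [Finset.mem_filter] at hs ⊢
        exact ⟨hs.1, hs.2.trans hat⟩
      · exact lt_irrefl a (Finset.mem_filter.1 (hsub hamem)).2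
    obtain ⟨fA, fB, hfA, hfB, hle⟩ := ih _ hcard a rfl
    have hlaw : ∀ C : Schedule V, (∀ i, C.time i ∈ T) → C.law G β h lam ν t
        = (C.law G β h lam ν a).bind (heatFlow G β h lam (C.rightLim a) (t - a)) := fun C hC => by
      rw [Schedule.law, C.kernel_eq_heatFlow_comp G h lam hat fun i => hnot _ (hC i),
        ← Measure.comp_assoc]
      rfl
    have hA := hfA.bind_heatFlow G h lam hβ hh (A.rightLim a) (t - a)
    have hB := hfB.bind_heatFlow G h lam hβ hh (B.rightLim a) (t - a)
    rw [← hlaw A hTA] at hA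
    rw [← hlaw B hTB] at hB
    refine ⟨_, _, hA, hB, fun g hg hgm => ?_⟩
    -- With `Q_A` and `Q_B` the flows on the last interval, the chain is `∫ fB (Q_B g) ≤ ∫ fA (Q_B
    -- g) ≤ ∫ fA (Q_A g)`: induction applied to the increasing function `Q_B g`, then censoring on
    -- one interval with `fA` increasing.
    have hsym := isSymmetricKernel_heatFlow G h lam hβ hh
    rw [← hsym _ _ _ _ hfB.measurable hg, ← hsym _ _ _ _ hfA.measurable hg]
    exact (hle _ (measurable_act _ hg) (configMono_act_heatFlow G h lam hβ hh _ _ hg hgm)).trans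
      (lintegral_mul_act_heatFlow_le G h lam hβ hh (Schedule.rightLim_mono hAB a) _
        hfA.measurable hg hfA.mono hgm)

lemma isProbabilityMeasure_law (hβ : 0 < β) (hh : ∀ x, Integrable (h x) (timeMeasure β))
    (A : Schedule V) (ν : Measure (Config V β)) [IsProbabilityMeasure ν] (t : ℝ≥0) :
    IsProbabilityMeasure (A.law G β h lam ν t) := by
  have hK : IsMarkovKernel (A.kernel G β h lam t) := by
    have : ∀ (l : List (Fin (A.n + 1))) (κ : Kernel (Config V β) (Config V β)), IsMarkovKernel κ →
        IsMarkovKernel (l.foldl (fun κ i =>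
          heatFlow G β h lam (A.rightLim (A.time i)) (A.duration t i) ∘ₖ κ) κ) := by
      intro l
      induction l with
      | nil => exact fun κ hκ => hκ
      | cons i l ih =>
        intro κ hκ
        have := isMarkovKernel_heatFlow G h lam hβ hh (A.rightLim (A.time i)) (A.duration t i)
        exact ih _ inferInstance
    exact this _ _ inferInstance
  rw [Schedule.law]
  infer_instance

end Comparison

/-! ### Comparison of variance, entropy and total variation -/

section Functionals

variable {Ω : Type*} [MeasurableSpace Ω] {μ : Measure Ω}

lemma integrable_of_abs_le [IsFiniteMeasure μ] {f : Ω → ℝ} (hf : Measurable f) {C : ℝ}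
    (hC : ∀ ω, |f ω| ≤ C) : Integrable f μ :=
  Integrable.of_bound hf.aestronglyMeasurable C (Eventually.of_forall hC)

lemma measurable_mul_log {f : Ω → ℝ} (hf : Measurable f) :
    Measurable fun ω => f ω * Real.log (f ω) :=
  hf.mul (Real.measurable_log.comp hf)

lemma integrable_mul_log [IsFiniteMeasure μ] {f : Ω → ℝ} (hf : Measurable f) {M : ℝ}
    (hf0 : ∀ ω, 0 ≤ f ω) (hM : ∀ ω, f ω ≤ M) : Integrable (fun ω => f ω * Real.log (f ω)) μ := by
  obtain ⟨C, hC⟩ := (isCompact_Icc (a := (0 : ℝ)) (b := M)).exists_bound_of_continuousOn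
    Real.continuous_mul_log.continuousOn
  exact integrable_of_abs_le (measurable_mul_log hf) fun ω => hC _ ⟨hf0 ω, hM ω⟩

lemma integral_sq_le_of_integral_mul_le {f g : Ω → ℝ} (hf : Integrable (fun ω => f ω ^ 2) μ)
    (hg : Integrable (fun ω => g ω ^ 2) μ) (hfg : Integrable (fun ω => f ω * g ω) μ)
    (hle : ∫ ω, g ω ^ 2 ∂μ ≤ ∫ ω, f ω * g ω ∂μ) : ∫ ω, g ω ^ 2 ∂μ ≤ ∫ ω, f ω ^ 2 ∂μ := by
  have h1 : ∫ ω, f ω * g ω ∂μ ≤ ∫ ω, (f ω ^ 2 + g ω ^ 2) / 2 ∂μ :=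
    integral_mono hfg ((hf.add hg).div_const 2) fun ω => by
      nlinarith [sq_nonneg (f ω - g ω)]
  rw [integral_div, integral_add hf hg] at h1
  linarith

/-- This is `log y ≤ y - 1` at `y = c / a`, multiplied by `a`: the pointwise form of Gibbs'
inequality. -/
lemma sub_le_mul_log_sub {a c : ℝ} (ha : 0 ≤ a) (hc : 0 < c) :
    a - c ≤ a * Real.log a - a * Real.log c := by
  rcases ha.eq_or_lt with rfl | ha
  · simp [hc.le]
  · have h1 := Real.log_le_sub_one_of_pos (div_pos hc ha)
    rw [Real.log_div hc.ne' ha.ne'] at h1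
    have h2 := mul_le_mul_of_nonneg_left h1 ha.le
    have h3 : a * (c / a - 1) = c - a := by field_simp
    rw [h3] at h2
    linarith

lemma mul_log_le_mul_log_add {b ε : ℝ} (hb : 0 ≤ b) (hε : 0 < ε) :
    b * Real.log b ≤ b * Real.log (b + ε) := by
  rcases hb.eq_or_lt with rfl | hb
  · simp
  · exact mul_le_mul_of_nonneg_left (Real.log_le_log hb (by linarith)) hb.le

/-- The test function is `log (g + ε)` because `log g` is unbounded near the zeros of `g`, and the
convention `Real.log 0 = 0` would destroy its monotonicity. -/
lemma integral_mul_log_le [IsProbabilityMeasure μ] {f g : Ω → ℝ} (hf : Measurable f)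
    (hg : Measurable g) {M : ℝ} (hf0 : ∀ ω, 0 ≤ f ω) (hg0 : ∀ ω, 0 ≤ g ω) (hfM : ∀ ω, f ω ≤ M)
    (hgM : ∀ ω, g ω ≤ M) (hf1 : ∫ ω, f ω ∂μ = 1) (hg1 : ∫ ω, g ω ∂μ = 1)
    (hle : ∀ ε : ℝ, 0 < ε →
      ∫ ω, g ω * Real.log (g ω + ε) ∂μ ≤ ∫ ω, f ω * Real.log (g ω + ε) ∂μ) :
    ∫ ω, g ω * Real.log (g ω) ∂μ ≤ ∫ ω, f ω * Real.log (f ω) ∂μ := by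
  refine le_of_forall_pos_le_add fun ε hε => ?_
  have hfi : Integrable f μ := integrable_of_abs_le hf fun ω => by
    rw [abs_of_nonneg (hf0 ω)]; exact hfM ω
  have hgi : Integrable g μ := integrable_of_abs_le hg fun ω => by
    rw [abs_of_nonneg (hg0 ω)]; exact hgM ω
  have hlog : ∀ {k : Ω → ℝ}, Integrable k μ → Integrable (fun ω => k ω * Real.log (g ω + ε)) μ :=
    fun hk => by
      refine hk.mul_bdd (c := max |Real.log ε| |Real.log (M + ε)|)
        (Real.measurable_log.comp (hg.add_const ε)).aestronglyMeasurable
        (Eventually.of_forall fun ω => ?_)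
      rw [Real.norm_eq_abs]
      exact abs_le_max_abs_abs (Real.log_le_log hε (by linarith [hg0 ω]))
        (Real.log_le_log (by linarith [hg0 ω]) (by linarith [hgM ω]))
  calc ∫ ω, g ω * Real.log (g ω) ∂μ ≤ ∫ ω, g ω * Real.log (g ω + ε) ∂μ :=
        integral_mono (integrable_mul_log hg hg0 hgM) (hlog hgi)
          fun ω => mul_log_le_mul_log_add (hg0 ω) hε
    _ ≤ ∫ ω, f ω * Real.log (g ω + ε) ∂μ := hle ε hε
    -- Since `f` and `g` both have integral `1`, the added term integrates to `-ε`.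
    _ = ∫ ω, (f ω * Real.log (g ω + ε) + (f ω - (g ω + ε))) ∂μ + ε := by
        have h2 : Integrable (fun ω => g ω + ε) μ := hgi.add (integrable_const ε)
        have h3 : Integrable (fun ω => f ω - (g ω + ε)) μ := hfi.sub h2
        rw [integral_add (hlog hfi) h3, integral_sub hfi h2,
          integral_add hgi (integrable_const ε), hf1, hg1]
        simp
    _ ≤ ∫ ω, f ω * Real.log (f ω) ∂μ + ε := by
        refine add_le_add (integral_mono ((hlog hfi).add (hfi.sub (hgi.add (integrable_const ε))))
          (integrable_mul_log hf hf0 hfM) fun ω => ?_) le_rfl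
        have := sub_le_mul_log_sub (hf0 ω) (show 0 < g ω + ε by linarith [hg0 ω])
        simp only
        linarith

/-- The difference on `S` is the integral of `g - 1` over `S`, largest where the integrand is
positive; the opposite sign follows by taking complements. -/
lemma abs_measureReal_sub_le [IsProbabilityMeasure μ] {ν : Measure Ω} [IsProbabilityMeasure ν]
    {g : Ω → ℝ} (hg : Measurable g) (hgi : Integrable g μ)
    (hν : ∀ S, MeasurableSet S → ν.real S = ∫ ω in S, g ω ∂μ) {S : Set Ω} (hS : MeasurableSet S) :
    |ν.real S - μ.real S| ≤ ν.real {ω | 1 < g ω} - μ.real {ω | 1 < g ω} := by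
  have hD : MeasurableSet {ω | 1 < g ω} := measurableSet_lt measurable_const hg
  have hgi1 : Integrable (fun ω => g ω - 1) μ := hgi.sub (integrable_const 1)
  have hsub : ∀ S, MeasurableSet S →
      ν.real S - μ.real S = ∫ ω, S.indicator (fun ω => g ω - 1) ω ∂μ := fun S hS => by
    rw [integral_indicator hS, integral_sub hgi.integrableOn (integrable_const 1).integrableOn,
      hν S hS]
    simp
  have hle : ∀ S, MeasurableSet S →
      ν.real S - μ.real S ≤ ν.real {ω | 1 < g ω} - μ.real {ω | 1 < g ω} := fun S hS => by
    rw [hsub S hS, hsub _ hD]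
    refine integral_mono (hgi1.indicator hS) (hgi1.indicator hD) fun ω => ?_
    by_cases h1 : 1 < g ω
    · rw [indicator_of_mem (show ω ∈ {ω | 1 < g ω} from h1)]
      by_cases hω : ω ∈ S
      · rw [indicator_of_mem hω]
      · rw [indicator_of_notMem hω]
        linarith
    · rw [indicator_of_notMem (show ω ∉ {ω | 1 < g ω} from h1)]
      by_cases hω : ω ∈ S
      · rw [indicator_of_mem hω]
        linarith
      · rw [indicator_of_notMem hω]
  refine abs_le.2 ⟨?_, hle S hS⟩
  have h2 := hle Sᶜ hS.compl
  rw [probReal_compl_eq_one_sub hS, probReal_compl_eq_one_sub hS] at h2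
  linarith

lemma tvDist_le_of_measureReal_le [IsProbabilityMeasure μ] {ν ν' : Measure Ω}
    [IsProbabilityMeasure ν] [IsProbabilityMeasure ν'] {g : Ω → ℝ} (hg : Measurable g)
    (hgi : Integrable g μ) (hν : ∀ S, MeasurableSet S → ν.real S = ∫ ω in S, g ω ∂μ)
    (hle : ν.real {ω | 1 < g ω} ≤ ν'.real {ω | 1 < g ω}) : tvDist ν μ ≤ tvDist ν' μ := by
  have : Nonempty {S : Set Ω // MeasurableSet S} := ⟨⟨∅, MeasurableSet.empty⟩⟩
  have hbdd : BddAbove (range fun S : {S : Set Ω // MeasurableSet S} =>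
      |ν'.real S.1 - μ.real S.1|) := by
    refine ⟨1, ?_⟩
    rintro _ ⟨S, rfl⟩
    have h1 : ν'.real S.1 ≤ 1 := measureReal_le_one
    have h2 : μ.real S.1 ≤ 1 := measureReal_le_one
    have h3 : 0 ≤ ν'.real S.1 := measureReal_nonneg
    have h4 : 0 ≤ μ.real S.1 := measureReal_nonneg
    exact abs_le.2 ⟨by linarith, by linarith⟩
  refine ciSup_le fun S => (abs_measureReal_sub_le hg hgi hν S.2).trans ?_
  refine (sub_le_sub_right hle _).trans ((le_abs_self _).trans ?_)
  exact le_ciSup hbdd ⟨{ω | 1 < g ω}, measurableSet_lt measurable_const hg⟩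

end Functionals

/-! ### Increasing functions and increasing densities -/

section Densities

variable {V : Type*} {β : ℝ}

/-- The constant paths. -/
def constPath (β : ℝ) (b : Bool) : SpinPath β := flipPath β b 0 fun i => i.elim0

lemma constPath_apply (b : Bool) (t : Icc (0 : ℝ) β) : (constPath β b).1 t = sgn b := by
  simp [constPath, flipPath]

lemma Increasing.le_top {f : Config V β → ℝ} (hf : Increasing f) (σ : Config V β) :
    f σ ≤ f fun _ => constPath β true :=
  hf _ _ fun x => Eventually.of_forall fun t => by
    rw [constPath_apply]
    rcases (σ x).2.1 t with h | h <;> norm_num [h, sgn]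

lemma Increasing.bot_le {f : Config V β → ℝ} (hf : Increasing f) (σ : Config V β) :
    (f fun _ => constPath β false) ≤ f σ :=
  hf _ _ fun x => Eventually.of_forall fun t => by
    rw [constPath_apply]
    rcases (σ x).2.1 t with h | h <;> norm_num [h, sgn]

lemma Increasing.exists_abs_le {f : Config V β → ℝ} (hf : Increasing f) : ∃ C, ∀ σ, |f σ| ≤ C :=
  ⟨_, fun σ => abs_le_max_abs_abs (hf.bot_le σ) (hf.le_top σ)⟩

lemma Increasing.configMono_ofReal {f : Config V β → ℝ} (hf : Increasing f) :
    ConfigMono fun σ => ENNReal.ofReal (f σ) :=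
  fun σ τ hστ => ENNReal.ofReal_le_ofReal (hf σ τ hστ)

variable {μ ν : Measure (Config V β)} {f : Config V β → ℝ≥0∞}

lemma IsMonoDensity.lt_top (hf : IsMonoDensity ν μ f) (σ : Config V β) : f σ < ∞ := by
  obtain ⟨M, hM⟩ := hf.bounded
  exact (hM σ).trans_lt ENNReal.coe_lt_top

lemma IsMonoDensity.measurable_toReal (hf : IsMonoDensity ν μ f) :
    Measurable fun σ => (f σ).toReal := hf.measurable.ennreal_toReal

lemma IsMonoDensity.increasing_toReal (hf : IsMonoDensity ν μ f) :
    Increasing fun σ => (f σ).toReal :=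
  fun σ τ hστ => ENNReal.toReal_mono (hf.lt_top τ).ne (hf.mono σ τ hστ)

lemma IsMonoDensity.density_ae_eq [SigmaFinite μ] (hf : IsMonoDensity ν μ f) :
    density ν μ =ᵐ[μ] fun σ => (f σ).toReal := by
  have h := Measure.rnDeriv_withDensity μ hf.measurable
  rw [← hf.eq_withDensity] at h
  filter_upwards [h] with σ hσ
  rw [density, hσ]

lemma IsMonoDensity.hasIncreasingDensity [SigmaFinite μ] (hf : IsMonoDensity ν μ f) :
    HasIncreasingDensity ν μ :=
  ⟨_, hf.measurable_toReal, hf.increasing_toReal, hf.density_ae_eq⟩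

lemma IsMonoDensity.integral_eq (hf : IsMonoDensity ν μ f) (g : Config V β → ℝ) :
    ∫ σ, g σ ∂ν = ∫ σ, (f σ).toReal * g σ ∂μ := by
  conv_lhs => rw [hf.eq_withDensity]
  exact integral_withDensity_eq_integral_toReal_smul hf.measurable
    (Eventually.of_forall hf.lt_top) g

lemma HasIncreasingDensity.exists_isMonoDensity [SigmaFinite μ] [SigmaFinite ν] (hν : ν ≪ μ)
    (h : HasIncreasingDensity ν μ) : ∃ f, IsMonoDensity ν μ f := by
  obtain ⟨f, hfm, hfi, hfe⟩ := h
  -- Negative values of the chosen version, possible only on a null set, are cut to zero; the bound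
  -- is the value at the all-plus configuration.
  refine ⟨fun σ => ENNReal.ofReal (f σ), hfm.ennreal_ofReal, hfi.configMono_ofReal,
    ⟨(f fun _ => constPath β true).toNNReal, fun σ => ENNReal.ofReal_le_ofReal (hfi.le_top σ)⟩, ?_⟩
  conv_lhs => rw [← Measure.withDensity_rnDeriv_eq ν μ hν]
  refine withDensity_congr_ae ?_
  filter_upwards [hfe, Measure.rnDeriv_ne_top ν μ] with σ hσ hσt
  rw [← hσ, density, ENNReal.ofReal_toReal hσt]

/-- Subtracting the value at the all-minus configuration makes `g` nonnegative, and the constant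
cancels because both laws have mass one. -/
lemma stochLE_of_lintegral_le [IsProbabilityMeasure μ] {ν' : Measure (Config V β)}
    [IsProbabilityMeasure ν] [IsProbabilityMeasure ν'] {f' : Config V β → ℝ≥0∞}
    (hf : IsMonoDensity ν μ f) (hf' : IsMonoDensity ν' μ f')
    (hle : ∀ g, Measurable g → ConfigMono g → ∫⁻ σ, f σ * g σ ∂μ ≤ ∫⁻ σ, f' σ * g σ ∂μ) :
    StochLE ν ν' := by
  intro g hg hgi
  obtain ⟨C, hC⟩ := hgi.exists_abs_le
  set c := g fun _ => constPath β false with hc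
  have hg0 : ∀ σ, 0 ≤ g σ - c := fun σ => sub_nonneg.2 (hgi.bot_le σ)
  have hinc : Increasing fun σ => g σ - c := fun σ τ hστ => sub_le_sub_right (hgi σ τ hστ) c
  have hgm : Measurable fun σ => ENNReal.ofReal (g σ - c) := (hg.sub_const c).ennreal_ofReal
  have key := hle _ hgm hinc.configMono_ofReal
  have hl : ∀ {ν : Measure (Config V β)} {f : Config V β → ℝ≥0∞}, IsMonoDensity ν μ f →
      ∫⁻ σ, f σ * ENNReal.ofReal (g σ - c) ∂μ = ∫⁻ σ, ENNReal.ofReal (g σ - c) ∂ν := fun hf => by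
    conv_rhs => rw [hf.eq_withDensity, lintegral_withDensity_eq_lintegral_mul _ hf.measurable hgm]
    rfl
  have hi : ∀ (ν : Measure (Config V β)) [IsProbabilityMeasure ν], Integrable g ν := fun ν _ =>
    integrable_of_abs_le hg hC
  have hr : ∀ (ν : Measure (Config V β)) [IsProbabilityMeasure ν],
      ∫⁻ σ, ENNReal.ofReal (g σ - c) ∂ν = ENNReal.ofReal (∫ σ, g σ ∂ν - c) := fun ν _ => by
    have hs : Integrable (fun σ => g σ - c) ν := (hi ν).sub (integrable_const c)
    rw [← ofReal_integral_eq_lintegral_ofReal hs (Eventually.of_forall hg0), integral_sub (hi ν) (integrable_const c)]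
    simp
  rw [hl hf, hl hf', hr ν, hr ν'] at key
  have h0 : 0 ≤ ∫ σ, g σ ∂ν' - c := by
    have h1 : ∫ _, c ∂ν' ≤ ∫ σ, g σ ∂ν' :=
      integral_mono (integrable_const c) (hi ν') fun σ => hgi.bot_le σ
    have h2 : ∫ _, c ∂ν' = c := by simp
    linarith
  have := (ENNReal.ofReal_le_ofReal_iff h0).1 key
  linarith

end Densities

end QuantumIsing

end

/-! ### The censoring comparison theorem -/

open QuantumIsing in
theorem proposition4p4 {V : Type*} [Fintype V] [DecidableEq V]
    (G : SimpleGraph V) [DecidableRel G.Adj]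
    (β : ℝ) (hβ : 0 < β) (h : V → Icc (0 : ℝ) β → ℝ)
    (hh : ∀ x, Integrable (h x) (timeMeasure β)) (lam : ℝ≥0)
    (A B : Schedule V) (hAB : ∀ t, A.toFun t ⊆ B.toFun t)
    (ν : Measure (Config V β)) [IsProbabilityMeasure ν]
    (hν : ν ≪ gibbs G β h lam)
    (hν2 : MemLp (density ν (gibbs G β h lam)) 2 (gibbs G β h lam))
    (hνinc : HasIncreasingDensity ν (gibbs G β h lam)) (t : ℝ≥0) :
    let μ := gibbs G β h lam
    let νA := A.law G β h lam ν t
    let νB := B.law G β h lam ν t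
    (νA ≪ μ ∧ νB ≪ μ) ∧
    (HasIncreasingDensity νA μ ∧ HasIncreasingDensity νB μ) ∧
    StochLE νB νA ∧
    (MemLp (density νA μ) 2 μ ∧ MemLp (density νB μ) 2 μ ∧
      Var[density νB μ; μ] ≤ Var[density νA μ; μ]) ∧
    (Integrable (fun σ => density νA μ σ * Real.log (density νA μ σ)) μ ∧
      Integrable (fun σ => density νB μ σ * Real.log (density νB μ σ)) μ ∧
      entropy μ (density νB μ) ≤ entropy μ (density νA μ)) ∧
    tvDist νB μ ≤ tvDist νA μ := by
  intro μ νA νB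
  have hμ : IsProbabilityMeasure μ := isProbabilityMeasure_gibbs G h lam hβ
  have hPA : IsProbabilityMeasure νA := isProbabilityMeasure_law G h lam hβ hh A ν t
  have hPB : IsProbabilityMeasure νB := isProbabilityMeasure_law G h lam hβ hh B ν t
  obtain ⟨f, hf⟩ := hνinc.exists_isMonoDensity hν
  obtain ⟨fA, fB, hA, hB, hle⟩ := exists_isMonoDensity_law G h lam hβ hh hAB hf t
  change IsMonoDensity νA μ fA at hA
  change IsMonoDensity νB μ fB at hB
  have hst : StochLE νB νA := stochLE_of_lintegral_le hB hA hle
  set FA : Config V β → ℝ := fun σ => (fA σ).toReal with hFA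
  set FB : Config V β → ℝ := fun σ => (fB σ).toReal with hFB
  have hmA : Measurable FA := hA.measurable_toReal
  have hmB : Measurable FB := hB.measurable_toReal
  have hiB : Increasing FB := hB.increasing_toReal
  have h0A : ∀ σ, 0 ≤ FA σ := fun σ => ENNReal.toReal_nonneg
  have h0B : ∀ σ, 0 ≤ FB σ := fun σ => ENNReal.toReal_nonneg
  obtain ⟨MA, hMA⟩ := hA.increasing_toReal.exists_abs_le
  obtain ⟨MB, hMB⟩ := hiB.exists_abs_le
  have hA' : ∀ σ, FA σ ≤ max MA MB := fun σ =>
    (le_abs_self _).trans ((hMA σ).trans (le_max_left _ _))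
  have hB' : ∀ σ, FB σ ≤ max MA MB := fun σ =>
    (le_abs_self _).trans ((hMB σ).trans (le_max_right _ _))
  have heA : density νA μ =ᵐ[μ] FA := hA.density_ae_eq
  have heB : density νB μ =ᵐ[μ] FB := hB.density_ae_eq
  have hIA : Integrable FA μ := integrable_of_abs_le hmA hMA
  have hIB : Integrable FB μ := integrable_of_abs_le hmB hMB
  have hLA : MemLp FA 2 μ := MemLp.of_bound hmA.aestronglyMeasurable MA (Eventually.of_forall hMA)
  have hLB : MemLp FB 2 μ := MemLp.of_bound hmB.aestronglyMeasurable MB (Eventually.of_forall hMB)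
  have h1A : ∫ σ, FA σ ∂μ = 1 := by
    have := hA.integral_eq fun _ => 1
    simpa using this.symm
  have h1B : ∫ σ, FB σ ∂μ = 1 := by
    have := hB.integral_eq fun _ => 1
    simpa using this.symm
  have hcmp : ∀ g : Config V β → ℝ, Measurable g → Increasing g →
      ∫ σ, FB σ * g σ ∂μ ≤ ∫ σ, FA σ * g σ ∂μ := fun g hg hgi => by
    rw [← hA.integral_eq g, ← hB.integral_eq g]
    exact hst g hg hgi
  have hentA : (fun σ => density νA μ σ * Real.log (density νA μ σ))
      =ᵐ[μ] fun σ => FA σ * Real.log (FA σ) := by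
    filter_upwards [heA] with σ hσ
    rw [hσ]
  have hentB : (fun σ => density νB μ σ * Real.log (density νB μ σ))
      =ᵐ[μ] fun σ => FB σ * Real.log (FB σ) := by
    filter_upwards [heB] with σ hσ
    rw [hσ]
  refine ⟨⟨?_, ?_⟩, ⟨hA.hasIncreasingDensity, hB.hasIncreasingDensity⟩, hst,
    ⟨(memLp_congr_ae heA).2 hLA, (memLp_congr_ae heB).2 hLB, ?_⟩, ⟨?_, ?_, ?_⟩, ?_⟩
  · rw [hA.eq_withDensity]
    exact withDensity_absolutelyContinuous _ _
  · rw [hB.eq_withDensity]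
    exact withDensity_absolutelyContinuous _ _
  · rw [variance_congr heA, variance_congr heB, variance_eq_sub hLA, variance_eq_sub hLB, h1A, h1B]
    refine sub_le_sub_right (integral_sq_le_of_integral_mul_le hLA.integrable_sq
      hLB.integrable_sq (hLA.integrable_mul hLB) ?_) _
    simp_rw [sq]
    -- The test function is `FB` itself: `∫ FB² ≤ ∫ FA FB`, and both means are `1`.
    exact hcmp FB hmB hiB
  · exact (integrable_congr hentA).2 (integrable_mul_log hmA h0A hA')
  · exact (integrable_congr hentB).2 (integrable_mul_log hmB h0B hB')
  · rw [entropy, entropy, integral_congr_ae hentA, integral_congr_ae hentB, integral_congr_ae heA,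
      integral_congr_ae heB, h1A, h1B]
    refine sub_le_sub_right (integral_mul_log_le hmA hmB h0A h0B hA' hB' h1A h1B fun ε hε => ?_) _
    refine hcmp _ (Real.measurable_log.comp (hmB.add_const ε)) fun σ τ hστ => ?_
    exact Real.log_le_log (by linarith [h0B σ]) (by linarith [hiB σ τ hστ])
  · refine tvDist_le_of_measureReal_le hmB hIB (fun S hS => ?_) ?_
    · have := hB.integral_eq (S.indicator fun _ => 1)
      rw [integral_indicator_const _ hS] at this
      rw [← integral_indicator hS]
      simp only [smul_eq_mul, mul_one] at this
      rw [this]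
      refine integral_congr_ae (Eventually.of_forall fun σ => ?_)
      by_cases hσ : σ ∈ S <;> simp [hσ, hFB]
    · have hD : MeasurableSet {σ | 1 < FB σ} := measurableSet_lt measurable_const hmB
      -- The optimal set for the law with density `FB` is increasing, so stochastic domination
      -- compares its probabilities.
      have := hst ({σ | 1 < FB σ}.indicator fun _ => 1) (measurable_const.indicator hD) ?_
      · simpa [integral_indicator_const _ hD] using this
      · intro σ τ hστ
        by_cases hσ : 1 < FB σ
        · have hτ : 1 < FB τ := hσ.trans_le (hiB σ τ hστ)
          simp [hσ, hτ]
        · rw [indicator_of_notMem (show σ ∉ {σ | 1 < FB σ} from hσ)]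
          exact indicator_nonneg (fun _ _ => zero_le_one) τ
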